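/- Let $I=[\xi,\eta]$ with $\xi<\eta$ be a compact interval, and let $f:I\to\mathbb{R}$ be a $C^2$ function (one-sided derivatives at the end points) such that $0<c_1\le |f''(x)|\le c_2$ for all $x\in I$, with constants $c_1,c_2$. For a real number $y$ let $\|y\|$ denote the distance from $y$ to the nearest integer. For integers $j_1,j_2$ and $\lambda>0$ put $$\mu(j_1,j_2,\lambda)=\{x\in I:\ \|j_1x+j_2f(x)\|<\lambda\},$$ and let $|\mu(j_1,j_2,\lambda)|$ be its Lebesgue measure. Then there is a constant $C>0$, depending only on $f$ and $I$, such that for every integer $J\ge 2$ and every $\lambda\in(0,\tfrac12)$ $$\sum_{\substack{(j_1,j_2)\in\mathbb{Z}^2,\ (j_1,j_2)\ne(0,0)\\ |j_1|,|j_2|\le J}}|\mu(j_1,j_2,\lambda)|\ \le\ C\left(\lambda J^2+\lambda^{1/2}J^{1/2}\log J\right).$$ -/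

import Mathlib

open MeasureTheory Set

/-- The distance `‖x‖` from a real number `x` to a nearest integer. -/
noncomputable def distNearestInt (x : ℝ) : ℝ := |x - (round x : ℝ)|

/-- The set `μ(j₁, j₂, lam) = {x ∈ [ξ, η] : ‖j₁ x + j₂ f(x)‖ < lam}`. -/
def muSet (f : ℝ → ℝ) (ξ η : ℝ) (j₁ j₂ : ℤ) (lam : ℝ) : Set ℝ :=
  {x | x ∈ Icc ξ η ∧ distNearestInt ((j₁ : ℝ) * x + (j₂ : ℝ) * f x) < lam}

/-- The pairs of integers `(j₁, j₂) ≠ (0, 0)` with `|j₁| ≤ J` and `|j₂| ≤ J`. -/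
noncomputable def nonzeroBox (J : ℕ) : Finset (ℤ × ℤ) :=
  (Finset.Icc (-(J : ℤ)) (J : ℤ) ×ˢ Finset.Icc (-(J : ℤ)) (J : ℤ)).erase (0, 0)

/-!
Replacing `f` by `-f` (which reflects the box) and extending it to the line, `f` may be taken
convex with curvature bounded above and below on all of `ℝ`; `QuadConvex` records exactly this.

For `j₂ ≠ 0` put `q = |j₂|`, `s = p / q` with `p = ±j₁`, and consider the phase `q (f x - s x)`. Away
from its stationary point the phase behaves like `q` times the square of the distance, so it spends a
proportion `O(lam)` of the interval within `lam` of the integers. The only excess comes from the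
integer nearest to the stationary value `-q G(s)`, where `G` is the Legendre transform of `f`: it is
`O(lam / √(q (t + lam)))` with `t = ‖q G(s)‖`, and occurs only for bounded `s`
(`QuadConvex.volume_real_le`). The terms `O(lam)` add up to `O(lam J ^ 2)`.

What remains is to show that `‖q G(p / q)‖` is rarely small, that is, to count rational points near
the convex graph of `G`. The number of primitive points of denominator at most `Q` within `ε` of the
graph is `O(Q + ε Q ^ 4)` (`QuadConvex.exists_card_nearPoint_le`). One may assume `ε Q ^ 2` small.
Divide the abscissas into `O(Q)` cells of length a small multiple of `1 / Q`. Three points in a cell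
have an integral determinant of absolute value below `1`, so the points of a cell are collinear.
Cells with at most two points are harmless. A line of height `H` with three points near the graph is
nearly tangent to it; spacing `H / Q ^ 2` along the line and convexity give `H ≤ Y` and `O(Y / H)`
points, with `Y ≍ √ε Q ^ 2`. Near tangency makes such a line determined by its direction, so there
are `O(H)` of them at height `H`, and in total they carry `O(Y ^ 2) = O(ε Q ^ 4)` points.

Multiples of primitive points cost a logarithm: `O(Q log Q + ε Q ^ 4)` in all
(`QuadConvex.exists_card_nearness_le`). Summation over dyadic ranges of the distance to the graph
gives `O(lam Q ^ 2 + √(lam Q) log Q)` for `q` of size `Q`, and summation over dyadic `Q ≤ J` gives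
the two terms of the estimate (`QuadConvex.exists_sum_le`).
-/

/-! ### Functions trapped between parabolas -/

/-- `f` is trapped between two parabolas of curvatures `2 * a > 0` and `2 * b` touching it at each
point `x`, with common slope `g x` there. Only this consequence of `2 * a ≤ f'' ≤ 2 * b` is used;
it passes to the Legendre transform (`QuadConvex.dual`) without any further differentiation. -/
structure QuadConvex (f g : ℝ → ℝ) (a b : ℝ) : Prop where
  pos : 0 < a
  lower : ∀ x y, a * (y - x) ^ 2 ≤ f y - f x - g x * (y - x)
  upper : ∀ x y, f y - f x - g x * (y - x) ≤ b * (y - x) ^ 2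

namespace QuadConvex

variable {f g : ℝ → ℝ} {a b : ℝ}

theorem le (H : QuadConvex f g a b) : a ≤ b := by
  have h1 := H.lower 0 1
  have h2 := H.upper 0 1
  linarith

theorem pos' (H : QuadConvex f g a b) : 0 < b := H.pos.trans_le H.le

theorem slope_lower (H : QuadConvex f g a b) (x y : ℝ) :
    2 * a * (y - x) ^ 2 ≤ (g y - g x) * (y - x) := by
  have h1 := H.lower x y
  have h2 := H.lower y x
  nlinarith

theorem slope_upper (H : QuadConvex f g a b) (x y : ℝ) :
    (g y - g x) * (y - x) ≤ 2 * b * (y - x) ^ 2 := by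
  have h1 := H.upper x y
  have h2 := H.upper y x
  nlinarith

theorem abs_lower (H : QuadConvex f g a b) (x y : ℝ) :
    2 * a * |y - x| ≤ |g y - g x| := by
  rcases eq_or_ne x y with rfl | hne
  · simp
  have h : 0 < |y - x| := abs_pos.2 (sub_ne_zero.2 hne.symm)
  have h1 := (H.slope_lower x y).trans (le_abs_self _)
  rw [abs_mul, ← sq_abs, sq, ← mul_assoc] at h1
  exact le_of_mul_le_mul_right h1 h

theorem abs_upper (H : QuadConvex f g a b) (x y : ℝ) :
    |g y - g x| ≤ 2 * b * |y - x| := by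
  rcases eq_or_ne x y with rfl | hne
  · simp
  have h : 0 < |y - x| := abs_pos.2 (sub_ne_zero.2 hne.symm)
  have h0 : 0 ≤ (g y - g x) * (y - x) :=
    le_trans (mul_nonneg (by linarith [H.pos]) (sq_nonneg _)) (H.slope_lower x y)
  have h1 := H.slope_upper x y
  rw [← abs_of_nonneg h0, abs_mul, ← sq_abs (y - x), sq, ← mul_assoc] at h1
  exact le_of_mul_le_mul_right h1 h

/-- The Legendre transform of `f`, written through a right inverse `h` of the slope `g`: its
deviation from the tangent at `s` equals a deviation of `f` from the tangent at `h t`. -/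
theorem dual (H : QuadConvex f g a b) {h : ℝ → ℝ} (hh : ∀ s, g (h s) = s) :
    QuadConvex (fun s => s * h s - f (h s)) h (a / (4 * b ^ 2)) (b / (4 * a ^ 2)) := by
  have hb := H.pos'
  have ha := H.pos
  refine ⟨by positivity, fun s t => ?_, fun s t => ?_⟩
  · have h1 := H.lower (h t) (h s)
    have h2 := H.abs_upper (h s) (h t)
    rw [hh] at h1
    rw [hh, hh] at h2
    have h3 : (t - s) ^ 2 ≤ (2 * b) ^ 2 * (h t - h s) ^ 2 := by
      rw [← sq_abs, ← sq_abs (h t - h s), ← mul_pow]; gcongr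
    have h4 : a / (4 * b ^ 2) * (t - s) ^ 2 ≤ a * (h s - h t) ^ 2 := by
      rw [div_mul_eq_mul_div, div_le_iff₀ (by positivity)]; nlinarith
    linarith
  · have h1 := H.upper (h t) (h s)
    have h2 := H.abs_lower (h s) (h t)
    rw [hh] at h1
    rw [hh, hh] at h2
    have h3 : (2 * a) ^ 2 * (h t - h s) ^ 2 ≤ (t - s) ^ 2 := by
      rw [← sq_abs (t - s), ← sq_abs (h t - h s), ← mul_pow]; gcongr
    have h4 : b * (h s - h t) ^ 2 ≤ b / (4 * a ^ 2) * (t - s) ^ 2 := by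
      rw [div_mul_eq_mul_div, le_div_iff₀ (by positivity)]; nlinarith
    linarith

/-- When moving away from `x₀`, the increment of `f` minus its tangent direction at `x₀` is
comparable to the increment of the squared distance to `x₀`. -/
theorem growth (H : QuadConvex f g a b) {x₀ x y : ℝ}
    (hs : 0 ≤ (x - x₀) * (y - x)) :
    a * ((y - x₀) ^ 2 - (x - x₀) ^ 2) ≤ (f y - g x₀ * y) - (f x - g x₀ * x) ∧
    (f y - g x₀ * y) - (f x - g x₀ * x) ≤ b * ((y - x₀) ^ 2 - (x - x₀) ^ 2) := by
  have h1 := H.lower x y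
  have h2 := H.upper x y
  have h3 := H.slope_lower x₀ x
  have h4 := H.slope_upper x₀ x
  obtain ⟨h5, h6⟩ : 2 * a * ((x - x₀) * (y - x)) ≤ (g x - g x₀) * (y - x) ∧
      (g x - g x₀) * (y - x) ≤ 2 * b * ((x - x₀) * (y - x)) := by
    rcases eq_or_ne x x₀ with rfl | hne
    · simp
    have hp : 0 < (x - x₀) ^ 2 := by
      have := sub_ne_zero.2 hne
      positivity
    constructor
    · refine le_of_mul_le_mul_right ?_ hp
      nlinarith [mul_le_mul_of_nonneg_right h3 hs]
    · refine le_of_mul_le_mul_right ?_ hp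
      nlinarith [mul_le_mul_of_nonneg_right h4 hs]
  constructor <;> nlinarith

end QuadConvex

/-! ### The measure attached to one phase -/

theorem sum_inv_sqrt_le (N : ℕ) :
    ∑ m ∈ Finset.range N, 1 / √((m : ℝ) + 1) ≤ 2 * √(N : ℝ) := by
  induction N with
  | zero => simp
  | succ n ih =>
    rw [Finset.sum_range_succ]
    push_cast
    have h1 : 0 < √((n : ℝ) + 1) := by positivity
    have h2 := Real.sq_sqrt (show (0 : ℝ) ≤ n by positivity)
    have h3 := Real.sq_sqrt (show (0 : ℝ) ≤ (n : ℝ) + 1 by positivity)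
    have h4 : 1 / √((n : ℝ) + 1) ≤ 2 * √((n : ℝ) + 1) - 2 * √(n : ℝ) := by
      rw [div_le_iff₀ h1]
      nlinarith [sq_nonneg (√((n : ℝ) + 1) - √(n : ℝ))]
    linarith

theorem volume_real_le_of_dist_le {S : Set ℝ} {d : ℝ} (hd : 0 ≤ d)
    (h : ∀ x ∈ S, ∀ y ∈ S, |x - y| ≤ d) : volume.real S ≤ d ∧ volume S ≠ ⊤ := by
  have h1 : volume S ≤ ENNReal.ofReal d :=
    (Real.volume_le_diam S).trans (Metric.ediam_le_of_forall_dist_le fun x hx y hy => h x hx y hy)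
  exact ⟨ENNReal.toReal_le_of_le_ofReal hd h1, ne_top_of_le_ne_top ENNReal.ofReal_ne_top h1⟩

/-- Cutting a set according to the integer nearest to `F x`, and bounding the measure of each piece
by its diameter. -/
theorem volume_real_le_sum_of_round {S : Set ℝ} {F : ℝ → ℝ} {n₀ : ℤ} {N : ℕ} {d : ℕ → ℝ}
    (hd : ∀ m, 0 ≤ d m) (hS : ∀ x ∈ S, n₀ ≤ round (F x) ∧ round (F x) < n₀ + N)
    (h : ∀ m, ∀ x ∈ S, ∀ y ∈ S, round (F x) = n₀ + (m : ℕ) → round (F y) = n₀ + (m : ℕ) →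
      |x - y| ≤ d m) :
    volume.real S ≤ ∑ m ∈ Finset.range N, d m := by
  set T : ℕ → Set ℝ := fun m => {x | x ∈ S ∧ round (F x) = n₀ + (m : ℕ)}
  have hT : ∀ m, volume.real (T m) ≤ d m ∧ volume (T m) ≠ ⊤ := fun m =>
    volume_real_le_of_dist_le (hd m) fun x hx y hy => h m x hx.1 y hy.1 hx.2 hy.2
  have hsub : S ⊆ ⋃ m ∈ Finset.range N, T m := by
    intro x hx
    obtain ⟨h1, h2⟩ := hS x hx
    simp only [mem_iUnion, Finset.mem_range]
    exact ⟨(round (F x) - n₀).toNat, by omega, hx, by omega⟩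
  have hfin : volume (⋃ m ∈ Finset.range N, T m) ≠ ⊤ :=
    (measure_biUnion_lt_top (Finset.range N).finite_toSet
      fun m _ => (hT m).2.lt_top).ne
  calc volume.real S ≤ volume.real (⋃ m ∈ Finset.range N, T m) := measureReal_mono hsub hfin
    _ ≤ ∑ m ∈ Finset.range N, volume.real (T m) := measureReal_biUnion_finset_le _ _
    _ ≤ _ := Finset.sum_le_sum fun m _ => (hT m).1

theorem volume_real_le_of_expanding {S : Set ℝ} {F : ℝ → ℝ} {κ A W lam : ℝ} (hκ : 0 < κ)
    (hW : 0 ≤ W) (hlam : 0 < lam) (hexp : ∀ x ∈ S, ∀ y ∈ S, κ * |x - y| ≤ |F x - F y|)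
    (hF : ∀ x ∈ S, A ≤ F x ∧ F x ≤ A + W) (hS : ∀ x ∈ S, distNearestInt (F x) < lam) :
    volume.real S ≤ (W + 2) * (2 * lam / κ) := by
  have h1 := volume_real_le_sum_of_round (S := S) (F := F) (n₀ := ⌊A + 1 / 2⌋)
    (N := ⌊W⌋₊ + 2) (d := fun _ => 2 * lam / κ) (fun _ => by positivity) ?_ ?_
  · refine h1.trans ?_
    simp only [Finset.sum_const, Finset.card_range, nsmul_eq_mul]
    push_cast
    gcongr
    exact Nat.floor_le hW
  · intro x hx
    rw [round_eq]
    obtain ⟨h2, h3⟩ := hF x hx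
    refine ⟨Int.floor_mono (by linarith), ?_⟩
    rw [Int.floor_lt]
    push_cast
    have h4 := Int.lt_floor_add_one (A + 1 / 2)
    have h5 := Nat.lt_floor_add_one W
    linarith
  · intro m x hx y hy hxm hym
    have h2 := hS x hx
    have h3 := hS y hy
    rw [distNearestInt, hxm, abs_lt] at h2
    rw [distNearestInt, hym, abs_lt] at h3
    rw [le_div_iff₀ hκ, mul_comm]
    refine (hexp x hx y hy).trans (abs_le.2 ⟨by linarith, by linarith⟩)

/-- Away from `0`, closeness of two squares forces closeness of the roots. -/
theorem sq_sub_sq_bound {u v c B lam : ℝ} (hu : 0 ≤ u) (hv : 0 ≤ v) (hB : 0 < B) (hc : 0 < c)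
    (hBu : B ≤ u ^ 2) (hBv : B ≤ v ^ 2) (h : c * |u ^ 2 - v ^ 2| ≤ 2 * lam) :
    (u - v) ^ 2 ≤ lam ^ 2 / (c ^ 2 * B) := by
  have h1 : 4 * B ≤ (u + v) ^ 2 := by
    have : B ≤ u * v := by
      have h2 : B * B ≤ (u * v) * (u * v) := by nlinarith
      nlinarith [mul_nonneg hu hv, mul_self_le_mul_self_iff hB.le (mul_nonneg hu hv)]
    nlinarith
  have h2 : (c * |u ^ 2 - v ^ 2|) ^ 2 ≤ (2 * lam) ^ 2 := by gcongr
  rw [mul_pow, sq_abs] at h2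
  rw [le_div_iff₀ (by positivity)]
  have h3 : 4 * ((u - v) ^ 2 * (c ^ 2 * B)) ≤ c ^ 2 * (u ^ 2 - v ^ 2) ^ 2 := by
    have : c ^ 2 * (u ^ 2 - v ^ 2) ^ 2 = c ^ 2 * (u - v) ^ 2 * (u + v) ^ 2 := by ring
    rw [this]
    nlinarith [mul_le_mul_of_nonneg_left h1 (mul_nonneg (sq_nonneg c) (sq_nonneg (u - v)))]
  linarith

theorem sub_sq_le_abs_sq_sub_sq {u v : ℝ} (hu : 0 ≤ u) (hv : 0 ≤ v) :
    (u - v) ^ 2 ≤ |u ^ 2 - v ^ 2| := by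
  rw [show u ^ 2 - v ^ 2 = (u - v) * (u + v) by ring, abs_mul, ← sq_abs, sq]
  refine mul_le_mul_of_nonneg_left ?_ (abs_nonneg _)
  rw [abs_of_nonneg (add_nonneg hu hv), abs_le]
  constructor <;> linarith

theorem two_mul_div_le {a b q lam t : ℝ} (ha : 0 < a) (hab : a ≤ b) (hq : 0 < q) (hlam : 0 < lam)
    (ht0 : 0 ≤ t) (ht : t ≤ 2 * lam) :
    2 * lam / (a * q) ≤ 6 * b / a ^ 2 * (lam ^ 2 / (q * (t + lam))) := by
  rw [div_mul_div_comm, div_le_div_iff₀ (by positivity) (by positivity)]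
  calc 2 * lam * (a ^ 2 * (q * (t + lam))) = 2 * lam * a * q * (a * (t + lam)) := by ring
    _ ≤ 2 * lam * a * q * (b * (3 * lam)) :=
      mul_le_mul_of_nonneg_left (mul_le_mul hab (by linarith) (by linarith) (by linarith))
        (by positivity)
    _ = 6 * b * lam ^ 2 * (a * q) := by ring

theorem sq_div_le {a b q lam t : ℝ} (ha : 0 < a) (hab : a ≤ b) (hq : 0 < q) (hlam : 0 < lam)
    (ht : 2 * lam ≤ t) :
    lam ^ 2 / ((a * q) ^ 2 * (t / (2 * b * q))) ≤
      6 * b / a ^ 2 * (lam ^ 2 / (q * (t + lam))) := by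
  have ht0 : 0 < t := by linarith
  have hb : 0 < b := by linarith
  have e : lam ^ 2 / ((a * q) ^ 2 * (t / (2 * b * q))) = 2 * b * lam ^ 2 / (a ^ 2 * q) / t := by
    field_simp
  have e' : 6 * b / a ^ 2 * (lam ^ 2 / (q * (t + lam))) =
      2 * b * lam ^ 2 / (a ^ 2 * q) * (3 / (t + lam)) := by
    field_simp
    ring
  rw [e, e', div_eq_mul_one_div _ t]
  refine mul_le_mul_of_nonneg_left ?_ (by positivity)
  rw [div_le_div_iff₀ ht0 (by linarith)]
  linarith

/-- On one side `σ = ±1` of the stationary point `x₀`, within distance `ρ`. The integer nearest to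
the stationary value accounts for the term `lam / √(q (t + lam))`; the `m`-th integer after it
contributes `O(lam / √(q m))`, and only `O(q ρ ^ 2 + 1)` integers occur. -/
theorem QuadConvex.volume_real_near_side_le {f g : ℝ → ℝ} {a b : ℝ} (H : QuadConvex f g a b)
    {x₀ q ρ σ lam : ℝ} (hσ : σ ^ 2 = 1) (hq : 1 ≤ q) (hlam : 0 < lam) (hlam' : lam ≤ 1 / 4)
    {S : Set ℝ} (hS : ∀ x ∈ S, 0 ≤ σ * (x - x₀) ∧ σ * (x - x₀) ≤ ρ ∧
      distNearestInt (q * (f x - g x₀ * x)) < lam) :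
    volume.real S ≤ 4 / a * √(b * (b * ρ ^ 2 + 2)) * lam + √(6 * b / a ^ 2) *
      (lam / √(q * (distNearestInt (q * (f x₀ - g x₀ * x₀)) + lam))) := by
  have ha := H.pos
  have hb := H.pos'
  have hab := H.le
  have hq0 : 0 < q := by linarith
  set F : ℝ → ℝ := fun x => q * (f x - g x₀ * x) with hF
  set T := F x₀ with hT
  set n₀ : ℤ := round T with hn₀
  set t := distNearestInt T with ht
  have ht0 : 0 ≤ t := abs_nonneg _
  have htT : t = |T - n₀| := rfl
  have hthalf : |T - n₀| ≤ 1 / 2 := abs_sub_round T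
  -- growth of `F` in terms of the squared distance to `x₀`
  have hgrow : ∀ x, a * q * (σ * (x - x₀)) ^ 2 ≤ F x - T ∧
      F x - T ≤ b * q * (σ * (x - x₀)) ^ 2 := by
    intro x
    have h1 := H.growth (x₀ := x₀) (x := x₀) (y := x) (by simp)
    rw [mul_pow, hσ]
    simp only [hF, hT]
    constructor <;> nlinarith [h1.1, h1.2]
  have hpair' : ∀ x ∈ S, ∀ y ∈ S, σ * (x - x₀) ≤ σ * (y - x₀) →
      a * q * |(σ * (x - x₀)) ^ 2 - (σ * (y - x₀)) ^ 2| ≤ |F x - F y| := by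
    intro x hx y hy hxy
    have h0 := (hS x hx).1
    have h1 := H.growth (x₀ := x₀) (x := x) (y := y) (by
      have : 0 ≤ (σ * (x - x₀)) * (σ * (y - x₀) - σ * (x - x₀)) :=
        mul_nonneg h0 (by linarith)
      have h2 : (σ * (x - x₀)) * (σ * (y - x₀) - σ * (x - x₀)) = σ ^ 2 * ((x - x₀) * (y - x)) := by
        ring
      rwa [h2, hσ, one_mul] at this)
    have h2 : (σ * (x - x₀)) ^ 2 ≤ (σ * (y - x₀)) ^ 2 := by gcongr
    rw [abs_sub_comm, abs_of_nonneg (by linarith), abs_sub_comm, mul_pow, mul_pow, hσ]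
    refine le_trans ?_ (le_abs_self _)
    simp only [hF]
    nlinarith [h1.1]
  have hpair : ∀ x ∈ S, ∀ y ∈ S,
      a * q * |(σ * (x - x₀)) ^ 2 - (σ * (y - x₀)) ^ 2| ≤ |F x - F y| := by
    intro x hx y hy
    rcases le_total (σ * (x - x₀)) (σ * (y - x₀)) with h | h
    · exact hpair' x hx y hy h
    · rw [abs_sub_comm, abs_sub_comm (F x)]; exact hpair' y hy x hx h
  -- on one side of `x₀`, differences of points are differences of distances to `x₀`
  have hdist : ∀ x y, (x - y) ^ 2 = (σ * (x - x₀) - σ * (y - x₀)) ^ 2 := by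
    intro x y
    have : (σ * (x - x₀) - σ * (y - x₀)) ^ 2 = σ ^ 2 * (x - y) ^ 2 := by ring
    rw [this, hσ, one_mul]
  set N : ℕ := ⌊b * q * ρ ^ 2 + 1⌋₊ + 1 with hN
  set d : ℕ → ℝ := fun m => if m = 0 then √(6 * b / a ^ 2 * (lam ^ 2 / (q * (t + lam)))) else
    √(4 * b / a ^ 2 * (lam ^ 2 / q) / m) with hd
  have hround : ∀ x ∈ S, ∀ n : ℤ, round (F x) = n → |F x - n| < lam := by
    intro x hx n hn
    have h := (hS x hx).2.2
    rw [distNearestInt] at h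
    rw [← hn]
    exact h
  have key := volume_real_le_sum_of_round (S := S) (F := F) (n₀ := n₀) (N := N) (d := d) ?_ ?_ ?_
  · refine key.trans ?_
    rw [hN, Finset.sum_range_succ']
    have e0 : d 0 = √(6 * b / a ^ 2) * (lam / √(q * (t + lam))) := by
      simp only [hd, if_true]
      rw [Real.sqrt_mul (by positivity), Real.sqrt_div (sq_nonneg lam), Real.sqrt_sq hlam.le]
    have e1 : ∀ m : ℕ, d (m + 1) = √(4 * b / a ^ 2 * (lam ^ 2 / q)) * (1 / √((m : ℝ) + 1)) := by
      intro m
      simp only [hd, Nat.succ_ne_zero, if_false]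
      rw [Real.sqrt_div (by positivity)]
      push_cast
      ring
    rw [e0]
    gcongr
    simp_rw [e1]
    rw [← Finset.mul_sum]
    set k := ⌊b * q * ρ ^ 2 + 1⌋₊
    have hk : (k : ℝ) ≤ q * (b * ρ ^ 2 + 2) := by
      have := Nat.floor_le (show 0 ≤ b * q * ρ ^ 2 + 1 by positivity)
      nlinarith
    calc √(4 * b / a ^ 2 * (lam ^ 2 / q)) * ∑ i ∈ Finset.range k, 1 / √((i : ℝ) + 1)
        ≤ √(4 * b / a ^ 2 * (lam ^ 2 / q)) * (2 * √(q * (b * ρ ^ 2 + 2))) := by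
          gcongr
          exact (sum_inv_sqrt_le k).trans (by gcongr)
      _ = 2 * √((2 * lam / a) ^ 2 * (b * (b * ρ ^ 2 + 2))) := by
          rw [mul_left_comm, ← Real.sqrt_mul (by positivity)]
          congr 2
          field_simp
          ring
      _ = 4 / a * √(b * (b * ρ ^ 2 + 2)) * lam := by
          rw [Real.sqrt_mul (by positivity), Real.sqrt_sq (by positivity)]
          ring
  · intro m
    simp only [hd]
    split_ifs <;> positivity
  · intro x hx
    have h1 := hgrow x
    obtain ⟨h2, h3, -⟩ := hS x hx
    have h4 : 0 ≤ F x - T := le_trans (by positivity) h1.1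
    refine ⟨?_, ?_⟩
    · rw [hn₀, round_eq, round_eq]
      exact Int.floor_mono (by linarith)
    · have h5 : b * q * (σ * (x - x₀)) ^ 2 ≤ b * q * ρ ^ 2 := by gcongr
      have h6 := Nat.lt_floor_add_one (b * q * ρ ^ 2 + 1)
      have h7 := abs_le.1 hthalf
      rw [round_eq, Int.floor_lt, hN]
      push_cast
      linarith
  · intro m x hx y hy hxm hym
    have hx1 := hround x hx _ hxm
    have hy1 := hround y hy _ hym
    have hx2 := abs_lt.1 hx1
    have hy2 := abs_lt.1 hy1
    have hxy : |F x - F y| ≤ 2 * lam := abs_le.2 ⟨by linarith, by linarith⟩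
    have hp := (hpair x hx y hy).trans hxy
    have hx0 := (hS x hx).1
    have hy0 := (hS y hy).1
    have hxg := (hgrow x).2
    have hyg := (hgrow y).2
    have hTn := abs_le.1 hthalf
    push_cast at hx2 hy2
    simp only [hd]
    split_ifs with hm
    · subst hm
      simp only [Nat.cast_zero, add_zero] at hx2 hy2
      apply Real.abs_le_sqrt
      rw [hdist]
      rcases le_or_gt t (2 * lam) with hc | hc
      · have h1 := sub_sq_le_abs_sq_sub_sq hx0 hy0
        have h2 : |(σ * (x - x₀)) ^ 2 - (σ * (y - x₀)) ^ 2| ≤ 2 * lam / (a * q) := by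
          rw [le_div_iff₀ (by positivity)]; linarith
        refine h1.trans (h2.trans ?_)
        exact two_mul_div_le ha hab hq0 hlam ht0 hc
      -- `F ≥ T` on `S`, so an integer that far below `T` is not approached at all
      · have hsgn : T < n₀ := by
          by_contra hcon
          push Not at hcon
          have h1 : 0 ≤ F x - T := le_trans (by positivity) (hgrow x).1
          rw [htT, abs_of_nonneg (by linarith)] at hc
          linarith
        have htv : t = n₀ - T := by rw [htT, abs_of_neg (by linarith)]; ring
        have hB : ∀ z, F z - T ≤ b * q * (σ * (z - x₀)) ^ 2 → -lam < F z - n₀ →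
            t / (2 * b * q) ≤ (σ * (z - x₀)) ^ 2 := by
          intro z hz1 hz2
          rw [div_le_iff₀ (by positivity)]
          linarith
        refine (sq_sub_sq_bound hx0 hy0 (B := t / (2 * b * q)) (c := a * q) (by
          have : 0 < t := by linarith
          positivity) (by positivity)
          (hB x hxg hx2.1) (hB y hyg hy2.1) hp).trans ?_
        exact sq_div_le ha hab hq0 hlam hc.le
    -- the later integers are at distance at least `m / 4` above `T`, even after subtracting `lam`
    · have hm1 : (1 : ℝ) ≤ m := by exact_mod_cast Nat.one_le_iff_ne_zero.2 hm
      apply Real.abs_le_sqrt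
      rw [hdist]
      have hB : ∀ z, F z - T ≤ b * q * (σ * (z - x₀)) ^ 2 → -lam < F z - (n₀ + m) →
            m / (4 * b * q) ≤ (σ * (z - x₀)) ^ 2 := by
          intro z hz1 hz2
          rw [div_le_iff₀ (by positivity)]
          linarith
      refine (sq_sub_sq_bound hx0 hy0 (B := m / (4 * b * q)) (c := a * q) (by positivity)
        (by positivity) (hB x hxg hx2.1) (hB y hyg hy2.1) hp).trans (le_of_eq ?_)
      field_simp

/-- If the stationary point is at distance at least `1` from the interval, the phase is monotone on
it with increments comparable to those of a linear function, and no exceptional term occurs. -/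
theorem QuadConvex.volume_real_far_le {f g : ℝ → ℝ} {a b : ℝ} (H : QuadConvex f g a b)
    {x₀ q ξ η lam : ℝ} (hq : 1 ≤ q) (hlam : 0 < lam) (hξη : ξ < η)
    (hfar : x₀ ≤ ξ - 1 ∨ η + 1 ≤ x₀) {S : Set ℝ}
    (hS : ∀ x ∈ S, x ∈ Icc ξ η ∧ distNearestInt (q * (f x - g x₀ * x)) < lam) :
    volume.real S ≤ (b * (η - ξ) * (2 + 2 * (η - ξ)) + 2) / a * lam := by
  have ha := H.pos
  have hb := H.pos'
  have hq0 : 0 < q := by linarith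
  set l := η - ξ with hl
  have hl0 : 0 < l := sub_pos.2 hξη
  -- `u` is the end point of the interval nearest to `x₀`, and `σ` points from `x₀` to `u`
  obtain ⟨u, σ, hσ, hd, hI⟩ : ∃ u σ : ℝ, σ ^ 2 = 1 ∧ 1 ≤ σ * (u - x₀) ∧
      ∀ x ∈ Icc ξ η, 0 ≤ σ * (x - u) ∧ σ * (x - u) ≤ l := by
    rcases hfar with h | h
    · exact ⟨ξ, 1, by norm_num, by linarith, fun x hx =>
        ⟨by linarith [hx.1], by linarith [hx.2]⟩⟩
    · exact ⟨η, -1, by norm_num, by linarith, fun x hx =>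
        ⟨by linarith [hx.2], by linarith [hx.1]⟩⟩
  set d := σ * (u - x₀) with hdd
  set F : ℝ → ℝ := fun x => q * (f x - g x₀ * x) with hF
  -- the growth estimate along the direction `σ`
  have hg : ∀ x y, 0 ≤ σ * (x - u) → σ * (x - u) ≤ σ * (y - u) →
      a * q * ((σ * (y - u) - σ * (x - u)) * (2 * d)) ≤ F y - F x ∧
      F y - F x ≤ b * q * ((σ * (y - u) - σ * (x - u)) * (2 * d + 2 * (σ * (y - u)))) := by
    intro x y hx hxy
    have e1 : σ * (x - x₀) = d + σ * (x - u) := by rw [hdd]; ring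
    have h1 := H.growth (x₀ := x₀) (x := x) (y := y) (by
      have : 0 ≤ (σ * (x - x₀)) * (σ * (y - u) - σ * (x - u)) :=
        mul_nonneg (by linarith) (by linarith)
      have h2 : (σ * (x - x₀)) * (σ * (y - u) - σ * (x - u)) = σ ^ 2 * ((x - x₀) * (y - x)) := by
        ring
      rwa [h2, hσ, one_mul] at this)
    have e2 : (y - x₀) ^ 2 - (x - x₀) ^ 2 =
        (σ * (y - u) - σ * (x - u)) * (2 * d + σ * (x - u) + σ * (y - u)) := by
      have : (σ * (y - u) - σ * (x - u)) * (2 * d + σ * (x - u) + σ * (y - u)) =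
        σ ^ 2 * ((y - x₀) ^ 2 - (x - x₀) ^ 2) := by rw [hdd]; ring
      rw [this, hσ, one_mul]
    rw [e2] at h1
    have e3 : F y - F x = q * ((f y - g x₀ * y) - (f x - g x₀ * x)) := by simp only [hF]; ring
    rw [e3]
    have h3 : 0 ≤ σ * (y - u) - σ * (x - u) := by linarith
    constructor
    · calc a * q * ((σ * (y - u) - σ * (x - u)) * (2 * d))
          ≤ a * q * ((σ * (y - u) - σ * (x - u)) * (2 * d + σ * (x - u) + σ * (y - u))) :=
            mul_le_mul_of_nonneg_left (mul_le_mul_of_nonneg_left (by linarith) h3) (by positivity)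
        _ = q * (a * ((σ * (y - u) - σ * (x - u)) * (2 * d + σ * (x - u) + σ * (y - u)))) := by ring
        _ ≤ _ := by gcongr; exact h1.1
    · calc q * ((f y - g x₀ * y) - (f x - g x₀ * x))
          ≤ q * (b * ((σ * (y - u) - σ * (x - u)) * (2 * d + σ * (x - u) + σ * (y - u)))) := by
            gcongr; exact h1.2
        _ = b * q * ((σ * (y - u) - σ * (x - u)) * (2 * d + σ * (x - u) + σ * (y - u))) := by ring
        _ ≤ _ := mul_le_mul_of_nonneg_left (mul_le_mul_of_nonneg_left (by linarith) h3) (by positivity)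
  have hσa : |σ| = 1 := by
    have := sq_eq_sq₀ (abs_nonneg σ) zero_le_one
    rw [sq_abs, hσ, one_pow] at this
    exact this.1 rfl
  have hdist : ∀ x y, |x - y| = |σ * (y - u) - σ * (x - u)| := by
    intro x y
    have : σ * (y - u) - σ * (x - u) = σ * (y - x) := by ring
    rw [this, abs_mul, hσa, one_mul, abs_sub_comm]
  have hκ : 0 < 2 * a * q * d := by positivity
  have key := volume_real_le_of_expanding (S := S) (F := F) (κ := 2 * a * q * d) (A := F u)
    (W := b * q * (l * (2 * d + 2 * l))) (lam := lam) hκ (by positivity) hlam ?_ ?_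
      (fun x hx => (hS x hx).2)
  · refine key.trans ?_
    rw [mul_div_assoc', div_mul_eq_mul_div, div_le_div_iff₀ hκ ha]
    have h1 : b * q * (l * (2 * d + 2 * l)) + 2 ≤ q * d * (b * l * (2 + 2 * l) + 2) := by
      have : 1 ≤ q * d := by nlinarith
      have h2 : b * q * (l * (2 * l)) ≤ b * q * (l * (2 * l)) * d := le_mul_of_one_le_right (by positivity) hd
      nlinarith
    nlinarith [mul_le_mul_of_nonneg_right h1 (show 0 ≤ 2 * lam * a by positivity)]
  · have haux : ∀ x ∈ S, ∀ y ∈ S, σ * (x - u) ≤ σ * (y - u) →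
        2 * a * q * d * |x - y| ≤ |F x - F y| := by
      intro x hx y hy hxy
      have h1 := (hg x y (hI x (hS x hx).1).1 hxy).1
      rw [hdist, abs_of_nonneg (by linarith), abs_sub_comm]
      exact le_trans (by linarith) (le_abs_self _)
    intro x hx y hy
    rcases le_total (σ * (x - u)) (σ * (y - u)) with h | h
    · exact haux x hx y hy h
    · rw [abs_sub_comm, abs_sub_comm (F x)]; exact haux y hy x hx h
  · intro x hx
    have h0 := hI x (hS x hx).1
    have h1 := hg u x (by simp) (by simpa using h0.1)
    simp only [sub_self, mul_zero, sub_zero] at h1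
    constructor
    · have : 0 ≤ a * q * (σ * (x - u) * (2 * d)) := by
        have := h0.1
        positivity
      linarith
    · have : b * q * (σ * (x - u) * (2 * d + 2 * (σ * (x - u)))) ≤
        b * q * (l * (2 * d + 2 * l)) := by
        gcongr
        · have := h0.1
          positivity
        · exact h0.2
        · exact h0.2
      linarith

theorem distNearestInt_le (x : ℝ) (n : ℤ) : distNearestInt x ≤ |x - n| := round_le x n

theorem distNearestInt_neg (x : ℝ) : distNearestInt (-x) = distNearestInt x := by
  have h : ∀ y : ℝ, distNearestInt (-y) ≤ distNearestInt y := fun y => by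
    have h1 := distNearestInt_le (-y) (-round y)
    push_cast at h1
    rwa [show -y - -(round y : ℝ) = -(y - round y) by ring, abs_neg] at h1
  refine le_antisymm (h x) ?_
  simpa using h (-x)

/-- The measure attached to a single phase `q f - p x`. The second term is present only for bounded
slopes `p / q`; it involves the distance of the stationary value to the nearest integer, which is
expressed by the Legendre transform of `f` at `p / q`. -/
theorem QuadConvex.volume_real_le {f g : ℝ → ℝ} {a b : ℝ} (H : QuadConvex f g a b)
    {h : ℝ → ℝ} (hh : ∀ s, g (h s) = s) {ξ η : ℝ} (hξη : ξ < η) :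
    ∃ C M : ℝ, 0 < C ∧ 0 < M ∧ ∀ lam : ℝ, 0 < lam → lam ≤ 1 / 4 → ∀ q p : ℝ, 1 ≤ q →
      volume.real {x | x ∈ Icc ξ η ∧ distNearestInt (q * f x - p * x) < lam} ≤
        C * lam + if |p| ≤ M * q then
          C * (lam / √(q * (distNearestInt (q * (p / q * h (p / q) - f (h (p / q)))) + lam)))
          else 0 := by
  have ha := H.pos
  have hb := H.pos'
  set l := η - ξ with hl
  have hl0 : 0 < l := sub_pos.2 hξη
  set K₁ := (b * l * (2 + 2 * l) + 2) / a with hK₁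
  set K₂ := 4 / a * √(b * (b * (l + 1) ^ 2 + 2)) with hK₂
  set K₃ := √(6 * b / a ^ 2) with hK₃
  set M := |g (ξ - 1)| + |g (η + 1)| + 1 with hM
  have hK₁0 : 0 < K₁ := by positivity
  have hK₂0 : 0 ≤ K₂ := by positivity
  have hK₃0 : 0 ≤ K₃ := by positivity
  refine ⟨K₁ + 2 * K₂ + 2 * K₃, M, by positivity, by positivity, fun lam hlam hlam' q p hq => ?_⟩
  have hq0 : 0 < q := by linarith
  set s := p / q with hs
  set x₀ := h s with hx₀
  have hg : g x₀ = s := hh s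
  have hp : p = q * s := by rw [hs]; field_simp
  have hfun : ∀ x, q * f x - p * x = q * (f x - g x₀ * x) := fun x => by rw [hg, hp]; ring
  simp_rw [hfun]
  by_cases hfar : x₀ ≤ ξ - 1 ∨ η + 1 ≤ x₀
  · refine (H.volume_real_far_le hq hlam hξη hfar fun x hx => hx).trans ?_
    have h1 : 0 ≤ if |p| ≤ M * q then (K₁ + 2 * K₂ + 2 * K₃) *
        (lam / √(q * (distNearestInt (q * (s * x₀ - f x₀)) + lam))) else 0 := by
      split_ifs <;> positivity
    have h2 : K₁ * lam ≤ (K₁ + 2 * K₂ + 2 * K₃) * lam := by gcongr; linarith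
    linarith
  · push Not at hfar
    have hmono : ∀ x y, x ≤ y → g x ≤ g y := by
      intro x y hxy
      rcases hxy.eq_or_lt with rfl | hlt
      · exact le_rfl
      have := H.slope_lower x y
      have h2 : 0 ≤ 2 * a * (y - x) ^ 2 := by positivity
      nlinarith
    have hsM : |s| ≤ M := by
      have h1 := hmono _ _ hfar.1.le
      have h2 := hmono _ _ hfar.2.le
      rw [hg] at h1 h2
      rw [abs_le, hM]
      constructor
      · linarith [neg_abs_le (g (ξ - 1)), abs_nonneg (g (η + 1))]
      · linarith [le_abs_self (g (η + 1)), abs_nonneg (g (ξ - 1))]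
    have hpM : |p| ≤ M * q := by
      rw [hp, abs_mul, abs_of_pos hq0, mul_comm]
      gcongr
    rw [if_pos hpM]
    have hT : distNearestInt (q * (s * x₀ - f x₀)) = distNearestInt (q * (f x₀ - g x₀ * x₀)) := by
      rw [← distNearestInt_neg, hg]
      congr 1
      ring
    rw [hT]
    set w := lam / √(q * (distNearestInt (q * (f x₀ - g x₀ * x₀)) + lam)) with hw
    have hw0 : 0 ≤ w := by positivity
    set S := {x | x ∈ Icc ξ η ∧ distNearestInt (q * (f x - g x₀ * x)) < lam} with hS
    have hsub : S ⊆ (S ∩ {x | x₀ ≤ x}) ∪ (S ∩ {x | x ≤ x₀}) := by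
      intro x hx
      rcases le_total x₀ x with h | h
      · exact Or.inl ⟨hx, h⟩
      · exact Or.inr ⟨hx, h⟩
    have hfin : volume ((S ∩ {x | x₀ ≤ x}) ∪ (S ∩ {x | x ≤ x₀})) ≠ ⊤ := by
      refine ne_top_of_le_ne_top (measure_Icc_lt_top (a := ξ) (b := η)).ne (measure_mono ?_)
      rintro x (hx | hx) <;> exact hx.1.1
    have h1 := H.volume_real_near_side_le (x₀ := x₀) (σ := 1) (ρ := l + 1) (by norm_num) hq hlam
      hlam' (S := S ∩ {x | x₀ ≤ x}) (fun x hx => ⟨by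
        have : x₀ ≤ x := hx.2
        linarith, by linarith [hx.1.1.2], hx.1.2⟩)
    have h2 := H.volume_real_near_side_le (x₀ := x₀) (σ := -1) (ρ := l + 1) (by norm_num) hq hlam
      hlam' (S := S ∩ {x | x ≤ x₀}) (fun x hx => ⟨by
        have : x ≤ x₀ := hx.2
        linarith, by linarith [hx.1.1.1], hx.1.2⟩)
    have h3 := (measureReal_mono hsub hfin).trans (measureReal_union_le _ _)
    have h4 : 0 ≤ K₁ * lam + 2 * K₃ * lam := by positivity
    have h5 : 0 ≤ K₁ * w + 2 * K₂ * w := by positivity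
    linarith

theorem volume_real_linear_le {ξ η lam : ℝ} (hξη : ξ < η) (hlam : 0 < lam) {k : ℝ}
    (hk : 1 ≤ |k|) :
    volume.real {x | x ∈ Icc ξ η ∧ distNearestInt (k * x) < lam} ≤
      (2 * (η - ξ) + 4) * lam := by
  have hl : 0 < η - ξ := sub_pos.2 hξη
  have hk0 : 0 < |k| := by linarith
  have h := volume_real_le_of_expanding (S := {x | x ∈ Icc ξ η ∧ distNearestInt (k * x) < lam})
    (F := fun x => k * x) (κ := |k|) (A := k * ((ξ + η) / 2) - |k| * ((η - ξ) / 2))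
    (W := |k| * (η - ξ)) (lam := lam) hk0 (by positivity) hlam
    (fun x _ y _ => by rw [← mul_sub, abs_mul]) (fun x hx => ?_) (fun x hx => hx.2)
  · refine h.trans ?_
    rw [mul_div_assoc', div_le_iff₀ hk0]
    nlinarith [mul_le_mul_of_nonneg_left hk hlam.le]
  · have h1 : |k * (x - (ξ + η) / 2)| ≤ |k| * ((η - ξ) / 2) := by
      rw [abs_mul]
      gcongr
      rw [abs_le]
      constructor <;> linarith [hx.1.1, hx.1.2]
    rw [abs_le] at h1
    constructor <;> linarith [h1.1, h1.2]

/-! ### Integer points and lines -/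

/-- An integer vector with coprime entries, in Bézout form. -/
def IsPrimitive (v : ℤ × ℤ × ℤ) : Prop :=
  ∃ u₀ u₁ u₂ : ℤ, u₀ * v.1 + u₁ * v.2.1 + u₂ * v.2.2 = 1

theorem exists_isPrimitive (x y z : ℤ) (h : x ≠ 0) :
    ∃ (d : ℤ) (v : ℤ × ℤ × ℤ), 0 < d ∧ IsPrimitive v ∧ x = d * v.1 ∧ y = d * v.2.1 ∧
      z = d * v.2.2 := by
  obtain ⟨e, he⟩ : ∃ e : ℤ, e = (Int.gcd x y : ℤ) := ⟨_, rfl⟩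
  obtain ⟨d, hd⟩ : ∃ d : ℤ, d = (Int.gcd e z : ℤ) := ⟨_, rfl⟩
  have hd0 : d ≠ 0 := by
    rw [hd, he]
    simp [Int.gcd_eq_zero_iff, h]
  have hde : d ∣ e := hd ▸ Int.gcd_dvd_left e z
  have hdz : d ∣ z := hd ▸ Int.gcd_dvd_right e z
  have hex : e ∣ x := he ▸ Int.gcd_dvd_left x y
  have hey : e ∣ y := he ▸ Int.gcd_dvd_right x y
  obtain ⟨x', hx'⟩ : d ∣ x := hde.trans hex
  obtain ⟨y', hy'⟩ : d ∣ y := hde.trans hey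
  obtain ⟨z', hz'⟩ : d ∣ z := hdz
  have h1 : e = x * Int.gcdA x y + y * Int.gcdB x y := he ▸ Int.gcd_eq_gcd_ab x y
  have h2 : d = e * Int.gcdA e z + z * Int.gcdB e z := hd ▸ Int.gcd_eq_gcd_ab e z
  have hdpos : 0 < d := lt_of_le_of_ne (hd ▸ Int.natCast_nonneg _) (Ne.symm hd0)
  refine ⟨d, (x', y', z'), hdpos,
    ⟨Int.gcdA x y * Int.gcdA e z, Int.gcdB x y * Int.gcdA e z, Int.gcdB e z, ?_⟩, hx', hy', hz'⟩
  apply mul_left_cancel₀ hd0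
  simp only [mul_one]
  calc d * (Int.gcdA x y * Int.gcdA e z * x' + Int.gcdB x y * Int.gcdA e z * y' +
        Int.gcdB e z * z')
      = ((d * x') * Int.gcdA x y + (d * y') * Int.gcdB x y) * Int.gcdA e z +
        (d * z') * Int.gcdB e z := by ring
    _ = d := by rw [← hx', ← hy', ← hz', ← h1, ← h2]

/-- The line with homogeneous coordinates `j` passes through the point with homogeneous
coordinates `w = (q, p₁, p₂)`, that is, through `(p₁ / q, p₂ / q)`. -/
def Incident (j w : ℤ × ℤ × ℤ) : Prop := j.1 * w.1 + j.2.1 * w.2.1 + j.2.2 * w.2.2 = 0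

/-- The cross product of two integer points on a line is a multiple of the primitive vector of the
line; this is the statement for the last coordinate. -/
theorem IsPrimitive.dvd_cross {j w w' : ℤ × ℤ × ℤ} (hj : IsPrimitive j) (h : Incident j w)
    (h' : Incident j w') : j.2.2 ∣ w.1 * w'.2.1 - w'.1 * w.2.1 := by
  obtain ⟨u₀, u₁, u₂, hu⟩ := hj
  unfold Incident at h h'
  refine ⟨u₀ * (w.2.1 * w'.2.2 - w.2.2 * w'.2.1) + u₁ * (w.2.2 * w'.1 - w.1 * w'.2.2) +
    u₂ * (w.1 * w'.2.1 - w'.1 * w.2.1), ?_⟩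
  have e0 : j.1 * (w.1 * w'.2.1 - w'.1 * w.2.1) =
      j.2.2 * (w.2.1 * w'.2.2 - w.2.2 * w'.2.1) := by
    linear_combination w'.2.1 * h - w.2.1 * h'
  have e1 : j.2.1 * (w.1 * w'.2.1 - w'.1 * w.2.1) =
      j.2.2 * (w.2.2 * w'.1 - w.1 * w'.2.2) := by
    linear_combination w.1 * h' - w'.1 * h
  linear_combination (-(w.1 * w'.2.1 - w'.1 * w.2.1)) * hu + u₀ * e0 + u₁ * e1

/-- The determinant of three integer vectors, written as `(w₁ × w₂) ⬝ w₃`. -/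
def det3 (w₁ w₂ w₃ : ℤ × ℤ × ℤ) : ℤ :=
  (w₁.2.1 * w₂.2.2 - w₁.2.2 * w₂.2.1) * w₃.1 + (w₁.2.2 * w₂.1 - w₁.1 * w₂.2.2) * w₃.2.1 +
    (w₁.1 * w₂.2.1 - w₁.2.1 * w₂.1) * w₃.2.2

/-- The line through two points with distinct abscissas, by a primitive vector normalised to have
positive last coordinate. -/
theorem exists_line {w w' : ℤ × ℤ × ℤ} (h : w.1 * w'.2.1 - w.2.1 * w'.1 ≠ 0) :
    ∃ j : ℤ × ℤ × ℤ, IsPrimitive j ∧ 0 < j.2.2 ∧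
      ∀ z, det3 w w' z = 0 → Incident j z := by
  obtain ⟨d, v, hd, ⟨u₀, u₁, u₂, hu⟩, h2, h1, h0⟩ := exists_isPrimitive
    (w.1 * w'.2.1 - w.2.1 * w'.1) (w.2.2 * w'.1 - w.1 * w'.2.2)
    (w.2.1 * w'.2.2 - w.2.2 * w'.2.1) h
  have hv0 : v.1 ≠ 0 := by
    rintro h3
    rw [h3, mul_zero] at h2
    exact h h2
  have key : ∀ z, det3 w w' z = 0 → v.2.2 * z.1 + v.2.1 * z.2.1 + v.1 * z.2.2 = 0 := by
    intro z hz
    rw [det3, h0, h1, h2] at hz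
    apply mul_left_cancel₀ hd.ne'
    linear_combination hz
  rcases lt_or_gt_of_ne hv0 with hneg | hpos
  · refine ⟨(-v.2.2, -v.2.1, -v.1), ⟨-u₂, -u₁, -u₀, by simp only; linear_combination hu⟩,
      by simpa using hneg, fun z hz => ?_⟩
    have := key z hz
    simp only [Incident]
    linear_combination -this
  · refine ⟨(v.2.2, v.2.1, v.1), ⟨u₂, u₁, u₀, by simp only; linear_combination hu⟩,
      hpos, fun z hz => ?_⟩
    have := key z hz
    simp only [Incident]
    linear_combination this

/-! ### Rational points near a convex graph -/

/-- The abscissa `p₁ / q` of the rational point with homogeneous coordinates `(q, p₁, p₂)`. -/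
noncomputable def absc (w : ℤ × ℤ × ℤ) : ℝ := (w.2.1 : ℝ) / w.1

/-- The ordinate `p₂ / q` of the rational point with homogeneous coordinates `(q, p₁, p₂)`. -/
noncomputable def ordi (w : ℤ × ℤ × ℤ) : ℝ := (w.2.2 : ℝ) / w.1

/-- `w` is the primitive representative of a rational point of denominator at most `Q`, with
abscissa in `[-M, M]` and at vertical distance at most `ε` from the graph of `G`. -/
structure NearPoint (G : ℝ → ℝ) (M Q ε : ℝ) (w : ℤ × ℤ × ℤ) : Prop where
  prim : IsPrimitive w
  pos : 0 < w.1
  le : (w.1 : ℝ) ≤ Q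
  absc_le : |absc w| ≤ M
  near : |ordi w - G (absc w)| ≤ ε

namespace NearPoint

variable {G g : ℝ → ℝ} {a b M Q ε : ℝ} {w w' : ℤ × ℤ × ℤ}

theorem pos_real (h : NearPoint G M Q ε w) : (0 : ℝ) < w.1 := by exact_mod_cast h.pos

theorem absc_sub (h : NearPoint G M Q ε w) (h' : NearPoint G M Q ε w') :
    absc w' - absc w = ((w.1 * w'.2.1 - w'.1 * w.2.1 : ℤ) : ℝ) / (w.1 * w'.1) := by
  have h1 := h.pos_real
  have h2 := h'.pos_real
  unfold absc
  push_cast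
  field_simp

theorem ordi_sub (h : NearPoint G M Q ε w) (h' : NearPoint G M Q ε w') :
    ordi w' - ordi w = ((w.1 * w'.2.2 - w'.1 * w.2.2 : ℤ) : ℝ) / (w.1 * w'.1) := by
  have h1 := h.pos_real
  have h2 := h'.pos_real
  unfold ordi
  push_cast
  field_simp

/-- A nonzero multiple `n` of `k` stays at least `k / Q ^ 2` after division by the product of two
denominators of size at most `Q`. -/
theorem div_sq_le (h : NearPoint G M Q ε w) (h' : NearPoint G M Q ε w') {k n : ℤ} (hn : n ≠ 0)
    (hk : k ∣ n) (hk0 : 0 ≤ k) : (k : ℝ) / Q ^ 2 ≤ |(n : ℝ) / (w.1 * w'.1)| := by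
  have h1 := h.pos_real
  have h2 := h'.pos_real
  rw [abs_div, abs_of_pos (mul_pos h1 h2), sq]
  have h3 : k ≤ |n| := Int.le_of_dvd (abs_pos.2 hn) ((dvd_abs k n).2 hk)
  have h4 : (k : ℝ) ≤ |(n : ℝ)| := by exact_mod_cast h3
  have h5 : (0 : ℝ) ≤ k := by exact_mod_cast hk0
  exact div_le_div₀ (abs_nonneg _) h4 (by positivity)
    (mul_le_mul h.le h'.le h2.le (h1.le.trans h.le))

theorem eq_of_absc_eq (h : NearPoint G M Q ε w) (h' : NearPoint G M Q ε w')
    (hε : 2 * ε * Q ^ 2 < 1) (he : absc w = absc w') : w = w' := by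
  have hw := h.pos_real
  have hw' := h'.pos_real
  have hQ : 0 < Q := hw.trans_le h.le
  have e1 : w.1 * w'.2.1 - w'.1 * w.2.1 = 0 := by
    have := h.absc_sub h'
    rw [he, sub_self, eq_comm, div_eq_zero_iff] at this
    rcases this with h3 | h3
    · exact_mod_cast h3
    · exact absurd h3 (by positivity)
  have e2 : w.1 * w'.2.2 - w'.1 * w.2.2 = 0 := by
    by_contra hne
    have h3 := h.div_sq_le h' hne (one_dvd _) zero_le_one
    rw [← h.ordi_sub h'] at h3
    have h4 : |ordi w' - ordi w| ≤ 2 * ε := by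
      have h5 := abs_le.1 h.near
      have h6 := abs_le.1 h'.near
      rw [← he] at h6
      rw [abs_le]
      constructor <;> linarith
    have h5 := h3.trans h4
    rw [div_le_iff₀ (by positivity)] at h5
    push_cast at h5
    linarith
  obtain ⟨u₀, u₁, u₂, hu⟩ := h.prim
  obtain ⟨v₀, v₁, v₂, hv⟩ := h'.prim
  have d1 : w.1 ∣ w'.1 := ⟨u₀ * w'.1 + u₁ * w'.2.1 + u₂ * w'.2.2, by
    linear_combination (-w'.1) * hu - u₁ * e1 - u₂ * e2⟩
  have d2 : w'.1 ∣ w.1 := ⟨v₀ * w.1 + v₁ * w.2.1 + v₂ * w.2.2, by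
    linear_combination (-w.1) * hv + v₁ * e1 + v₂ * e2⟩
  have e0 : w.1 = w'.1 := Int.dvd_antisymm h.pos.le h'.pos.le d1 d2
  have hne := h.pos.ne'
  refine Prod.ext e0 (Prod.ext ?_ ?_)
  · apply mul_left_cancel₀ hne
    linear_combination -e1 + w.2.1 * e0
  · apply mul_left_cancel₀ hne
    linear_combination -e2 + w.2.2 * e0

/-- Rational points on a line of height `j.2.2` are spaced by at least `j.2.2 / Q ^ 2`. -/
theorem spacing (h : NearPoint G M Q ε w) (h' : NearPoint G M Q ε w')
    {j : ℤ × ℤ × ℤ} (hj : IsPrimitive j) (hj0 : 0 < j.2.2) (hw : Incident j w)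
    (hw' : Incident j w') (hne : absc w ≠ absc w') :
    (j.2.2 : ℝ) / Q ^ 2 ≤ |absc w' - absc w| := by
  have h1 := h.absc_sub h'
  have hn : w.1 * w'.2.1 - w'.1 * w.2.1 ≠ 0 := by
    intro h0
    rw [h0, Int.cast_zero, zero_div, sub_eq_zero] at h1
    exact hne h1.symm
  rw [h1]
  exact h.div_sq_le h' hn (hj.dvd_cross hw hw') hj0.le

theorem ordi_eq (h : NearPoint G M Q ε w) {j : ℤ × ℤ × ℤ} (hw : Incident j w) :
    j.1 + j.2.1 * absc w + j.2.2 * ordi w = 0 := by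
  have h1 := h.pos_real
  unfold Incident at hw
  have h2 : (j.1 : ℝ) * w.1 + j.2.1 * w.2.1 + j.2.2 * w.2.2 = 0 := by exact_mod_cast hw
  unfold absc ordi
  field_simp
  linarith

/-- Strict convexity: three collinear points near the graph cannot be far apart. -/
theorem mul_gap_le (H : QuadConvex G g a b) {w₁ w₂ w₃ j : ℤ × ℤ × ℤ}
    (h₁ : NearPoint G M Q ε w₁) (h₂ : NearPoint G M Q ε w₂) (h₃ : NearPoint G M Q ε w₃)
    (hj0 : 0 < j.2.2) (hw₁ : Incident j w₁) (hw₂ : Incident j w₂) (hw₃ : Incident j w₃)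
    (h12 : absc w₁ < absc w₂) (h23 : absc w₂ < absc w₃) :
    a * ((absc w₂ - absc w₁) * (absc w₃ - absc w₂)) ≤ 2 * ε := by
  have hj : (0 : ℝ) < j.2.2 := by exact_mod_cast hj0
  have l1 := h₁.ordi_eq hw₁
  have l2 := h₂.ordi_eq hw₂
  have l3 := h₃.ordi_eq hw₃
  have n1 := abs_le.1 h₁.near
  have n2 := abs_le.1 h₂.near
  have n3 := abs_le.1 h₃.near
  have c1 := H.lower (absc w₂) (absc w₁)
  have c3 := H.lower (absc w₂) (absc w₃)
  set x₁ := absc w₁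
  set x₂ := absc w₂
  set x₃ := absc w₃
  set y₁ := ordi w₁
  set y₂ := ordi w₂
  set y₃ := ordi w₃
  have hcol : (x₂ - x₁) * (y₃ - y₂) = (x₃ - x₂) * (y₂ - y₁) := by
    apply mul_left_cancel₀ hj.ne'
    linear_combination (x₂ - x₁) * (l3 - l2) - (x₃ - x₂) * (l2 - l1)
  have hp : 0 < x₃ - x₁ := by linarith
  refine le_of_mul_le_mul_left ?_ hp
  have p1 : 0 < x₂ - x₁ := by linarith
  have p3 : 0 < x₃ - x₂ := by linarith
  nlinarith [mul_le_mul_of_nonneg_left c3 p1.le, mul_le_mul_of_nonneg_left c1 p3.le,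
    mul_le_mul_of_nonneg_left n1.2 p3.le, mul_le_mul_of_nonneg_left n1.1 p3.le,
    mul_le_mul_of_nonneg_left n3.2 p1.le, mul_le_mul_of_nonneg_left n2.1 hp.le]

/-- Three points near the graph with abscissas close together span a triangle of small area, so that
the integral determinant vanishes and the points are collinear. -/
theorem det3_eq_zero (H : QuadConvex G g a b) {w₁ w₂ w₃ : ℤ × ℤ × ℤ} {L : ℝ}
    (h₁ : NearPoint G M Q ε w₁) (h₂ : NearPoint G M Q ε w₂) (h₃ : NearPoint G M Q ε w₃)
    (h12 : |absc w₂ - absc w₁| ≤ L) (h13 : |absc w₃ - absc w₁| ≤ L)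
    (hL : Q ^ 3 * (2 * L * (b * L ^ 2 + 2 * ε)) < 1) : det3 w₁ w₂ w₃ = 0 := by
  have q1 := h₁.pos_real
  have q2 := h₂.pos_real
  have q3 := h₃.pos_real
  have hQ : 0 < Q := q1.trans_le h₁.le
  have hL0 : 0 ≤ L := (abs_nonneg _).trans h12
  have hε : 0 ≤ ε := (abs_nonneg _).trans h₁.near
  have hb := H.pos'
  have ha := H.pos
  have e : (det3 w₁ w₂ w₃ : ℝ) = w₁.1 * w₂.1 * w₃.1 *
      ((absc w₂ - absc w₁) * (ordi w₃ - ordi w₁) - (absc w₃ - absc w₁) * (ordi w₂ - ordi w₁)) := by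
    unfold det3 absc ordi
    push_cast
    field_simp
    ring
  have hdev : ∀ w, NearPoint G M Q ε w → |absc w - absc w₁| ≤ L →
      |ordi w - ordi w₁ - g (absc w₁) * (absc w - absc w₁)| ≤ b * L ^ 2 + 2 * ε := by
    intro w hw hwL
    have n1 := abs_le.1 h₁.near
    have n2 := abs_le.1 hw.near
    have c1 := H.lower (absc w₁) (absc w)
    have c2 := H.upper (absc w₁) (absc w)
    have c3 : b * (absc w - absc w₁) ^ 2 ≤ b * L ^ 2 := by
      rw [← sq_abs]; gcongr
    have c4 : 0 ≤ a * (absc w - absc w₁) ^ 2 := by positivity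
    rw [abs_le]
    constructor <;> linarith
  have hb' : |(absc w₂ - absc w₁) * (ordi w₃ - ordi w₁) -
      (absc w₃ - absc w₁) * (ordi w₂ - ordi w₁)| ≤ 2 * L * (b * L ^ 2 + 2 * ε) := by
    have : (absc w₂ - absc w₁) * (ordi w₃ - ordi w₁) - (absc w₃ - absc w₁) * (ordi w₂ - ordi w₁) =
      (absc w₂ - absc w₁) * (ordi w₃ - ordi w₁ - g (absc w₁) * (absc w₃ - absc w₁)) -
      (absc w₃ - absc w₁) * (ordi w₂ - ordi w₁ - g (absc w₁) * (absc w₂ - absc w₁)) := by ring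
    rw [this]
    refine (abs_sub _ _).trans ?_
    rw [abs_mul, abs_mul]
    have i1 := mul_le_mul h12 (hdev w₃ h₃ h13) (abs_nonneg _) hL0
    have i2 := mul_le_mul h13 (hdev w₂ h₂ h12) (abs_nonneg _) hL0
    linarith
  have hlt : |(det3 w₁ w₂ w₃ : ℝ)| < 1 := by
    rw [e, abs_mul, abs_of_pos (by positivity)]
    refine lt_of_le_of_lt ?_ hL
    have hq : (w₁.1 : ℝ) * w₂.1 * w₃.1 ≤ Q ^ 3 := by
      calc (w₁.1 : ℝ) * w₂.1 * w₃.1 ≤ Q * Q * Q :=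
            mul_le_mul (mul_le_mul h₁.le h₂.le q2.le hQ.le) h₃.le q3.le (by positivity)
        _ = Q ^ 3 := by ring
    exact mul_le_mul hq hb' (abs_nonneg _) (by positivity)
  exact Int.abs_lt_one_iff.1 (by exact_mod_cast hlt)

end NearPoint

theorem card_le_of_spacing {ι : Type*} (T : Finset ι) (x : ι → ℝ) {δ u κ : ℝ} (hδ : 0 < δ)
    (hκ : 0 ≤ κ) (hx : ∀ i ∈ T, u ≤ x i ∧ x i ≤ u + κ)
    (hsp : ∀ i ∈ T, ∀ k ∈ T, i ≠ k → δ ≤ |x i - x k|) : (T.card : ℝ) ≤ κ / δ + 1 := by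
  have h1 : T.card ≤ (Finset.range (⌊κ / δ⌋₊ + 1)).card := by
    refine Finset.card_le_card_of_injOn (fun i => ⌊(x i - u) / δ⌋₊) ?_ ?_
    · intro i hi
      have := hx i hi
      simp only [Finset.coe_range, mem_Iio]
      refine Nat.lt_succ_of_le (Nat.floor_le_floor ?_)
      gcongr
      linarith
    · intro i hi k hk hik
      by_contra hne
      have h2 := hsp i hi k hk hne
      have hi' := hx i hi
      have hk' := hx k hk
      simp only at hik
      have a1 := Nat.floor_le (show 0 ≤ (x i - u) / δ from div_nonneg (by linarith) hδ.le)
      have a2 := Nat.lt_floor_add_one ((x i - u) / δ)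
      have b1 := Nat.floor_le (show 0 ≤ (x k - u) / δ from div_nonneg (by linarith) hδ.le)
      have b2 := Nat.lt_floor_add_one ((x k - u) / δ)
      rw [← hik] at b1 b2
      have h3 : |(x i - u) / δ - (x k - u) / δ| < 1 := by
        rw [abs_lt]; constructor <;> linarith
      rw [← sub_div, abs_div, abs_of_pos hδ, div_lt_one hδ] at h3
      rw [show x i - u - (x k - u) = x i - x k by ring] at h3
      linarith
  rw [Finset.card_range] at h1
  have h2 : (T.card : ℝ) ≤ ⌊κ / δ⌋₊ + 1 := by exact_mod_cast h1
  have h3 := Nat.floor_le (show 0 ≤ κ / δ by positivity)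
  linarith

/-! ### Lines with at least three points -/

/-- A non-vertical line, given by its primitive vector with positive last coordinate, that contains
three points of `P` with distinct abscissas. -/
structure IsRichLine (P : Finset (ℤ × ℤ × ℤ)) (j : ℤ × ℤ × ℤ) : Prop where
  prim : IsPrimitive j
  pos : 0 < j.2.2
  three : ∃ w₁ ∈ P, ∃ w₂ ∈ P, ∃ w₃ ∈ P, Incident j w₁ ∧ Incident j w₂ ∧ Incident j w₃ ∧
    absc w₁ < absc w₂ ∧ absc w₂ < absc w₃

theorem exists_absc_lt_lt {T : Finset (ℤ × ℤ × ℤ)} (hT : 2 < T.card)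
    (hinj : ∀ w ∈ T, ∀ w' ∈ T, absc w = absc w' → w = w') :
    ∃ w₁ ∈ T, ∃ w₂ ∈ T, ∃ w₃ ∈ T, absc w₁ < absc w₂ ∧ absc w₂ < absc w₃ := by
  have hne : T.Nonempty := Finset.card_pos.1 (by omega)
  obtain ⟨w₁, h₁, hmin⟩ := T.exists_min_image absc hne
  obtain ⟨w₃, h₃, hmax⟩ := T.exists_max_image absc hne
  have hlt : 0 < ((T.erase w₁).erase w₃).card := by
    have h1 := Finset.pred_card_le_card_erase (s := T) (a := w₁)
    have h2 := Finset.pred_card_le_card_erase (s := T.erase w₁) (a := w₃)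
    omega
  obtain ⟨w₂, h₂⟩ := Finset.card_pos.1 hlt
  simp only [Finset.mem_erase] at h₂
  obtain ⟨h23, h21, h₂⟩ := h₂
  exact ⟨w₁, h₁, w₂, h₂, w₃, h₃,
    lt_of_le_of_ne (hmin w₂ h₂) fun h => h21 (hinj w₁ h₁ w₂ h₂ h).symm,
    lt_of_le_of_ne (hmax w₂ h₂) fun h => h23 (hinj w₂ h₂ w₃ h₃ h)⟩

section RichLines

variable {G g : ℝ → ℝ} {a b M Q ε : ℝ} {P : Finset (ℤ × ℤ × ℤ)} {j j' : ℤ × ℤ × ℤ}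

theorem IsRichLine.pos_real (hj : IsRichLine P j) : (0 : ℝ) < j.2.2 := by exact_mod_cast hj.pos

theorem mul_sqrt_sq {a ε : ℝ} (ha : 0 < a) (hε : 0 ≤ ε) : a * √(2 * ε / a) ^ 2 = 2 * ε := by
  rw [Real.sq_sqrt (div_nonneg (mul_nonneg zero_le_two hε) ha.le)]
  field_simp

/-- The height of a rich line is bounded, by comparing the spacing with `NearPoint.mul_gap_le`. -/
theorem IsRichLine.height_le (hj : IsRichLine P j) (H : QuadConvex G g a b)
    (hP : ∀ w ∈ P, NearPoint G M Q ε w) (hQ : 0 < Q) :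
    (j.2.2 : ℝ) ≤ √(2 * ε / a) * Q ^ 2 := by
  obtain ⟨w₁, h₁, w₂, h₂, w₃, h₃, i₁, i₂, i₃, h12, h23⟩ := hj.three
  have ha := H.pos
  have hj0 := hj.pos_real
  have s12 := (hP _ h₁).spacing (hP _ h₂) hj.prim hj.pos i₁ i₂ h12.ne
  have s23 := (hP _ h₂).spacing (hP _ h₃) hj.prim hj.pos i₂ i₃ h23.ne
  have hg := (hP _ h₁).mul_gap_le H (hP _ h₂) (hP _ h₃) hj.pos i₁ i₂ i₃ h12 h23
  rw [abs_of_pos (sub_pos.2 h12)] at s12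
  rw [abs_of_pos (sub_pos.2 h23)] at s23
  rw [← div_le_iff₀ (by positivity)]
  refine Real.le_sqrt_of_sq_le ?_
  rw [le_div_iff₀ ha, mul_comm]
  refine le_trans ?_ hg
  rw [sq]
  gcongr

/-- All points on a rich line lie within `√(2 * ε / a)` of the first or the last one, by
`NearPoint.mul_gap_le`, and they are spaced. -/
theorem IsRichLine.card_le (hj : IsRichLine P j) (H : QuadConvex G g a b)
    (hP : ∀ w ∈ P, NearPoint G M Q ε w) (hQ : 0 < Q) (hε : 0 ≤ ε)
    (hεQ : 2 * ε * Q ^ 2 < 1) {T : Finset (ℤ × ℤ × ℤ)} (hT : ∀ w ∈ T, w ∈ P ∧ Incident j w) :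
    (T.card : ℝ) ≤ 4 * (√(2 * ε / a) * Q ^ 2) / j.2.2 := by
  classical
  have ha := H.pos
  have hj0 := hj.pos_real
  have hY := hj.height_le H hP hQ
  set κ := √(2 * ε / a) with hκ
  have hκ0 : 0 ≤ κ := Real.sqrt_nonneg _
  have hκ2 : a * κ ^ 2 = 2 * ε := mul_sqrt_sq ha hε
  rcases T.eq_empty_or_nonempty with rfl | hne
  · simp only [Finset.card_empty, Nat.cast_zero]
    positivity
  obtain ⟨w₁, h₁, hmin⟩ := T.exists_min_image absc hne
  obtain ⟨w₃, h₃, hmax⟩ := T.exists_max_image absc hne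
  have hδ : 0 < (j.2.2 : ℝ) / Q ^ 2 := by positivity
  have hsp : ∀ w ∈ T, ∀ w' ∈ T, w ≠ w' → (j.2.2 : ℝ) / Q ^ 2 ≤ |absc w - absc w'| := by
    intro w hw w' hw' hne'
    refine (hP _ (hT _ hw').1).spacing (hP _ (hT _ hw).1) hj.prim hj.pos (hT _ hw').2 (hT _ hw).2 ?_
    intro he
    exact hne' ((hP _ (hT _ hw').1).eq_of_absc_eq (hP _ (hT _ hw).1) hεQ he).symm
  have hcover : ∀ w ∈ T, absc w ≤ absc w₁ + κ ∨ absc w₃ - κ ≤ absc w := by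
    intro w hw
    by_contra hcon
    push Not at hcon
    have hg := (hP _ (hT _ h₁).1).mul_gap_le H (hP _ (hT _ hw).1) (hP _ (hT _ h₃).1) hj.pos
      (hT _ h₁).2 (hT _ hw).2 (hT _ h₃).2 (by linarith) (by linarith)
    have : κ ^ 2 < (absc w - absc w₁) * (absc w₃ - absc w) := by nlinarith
    nlinarith
  have c1 := card_le_of_spacing (T.filter fun w => absc w ≤ absc w₁ + κ) absc (u := absc w₁) hδ hκ0
    (fun w hw => by
      rw [Finset.mem_filter] at hw
      exact ⟨hmin w hw.1, hw.2⟩)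
    (fun w hw w' hw' => hsp w (Finset.mem_filter.1 hw).1 w' (Finset.mem_filter.1 hw').1)
  have c2 := card_le_of_spacing (T.filter fun w => absc w₃ - κ ≤ absc w) absc (u := absc w₃ - κ)
    hδ hκ0 (fun w hw => by
      rw [Finset.mem_filter] at hw
      exact ⟨hw.2, by linarith [hmax w hw.1]⟩)
    (fun w hw w' hw' => hsp w (Finset.mem_filter.1 hw).1 w' (Finset.mem_filter.1 hw').1)
  have c3 : T.card ≤ (T.filter fun w => absc w ≤ absc w₁ + κ).card +
      (T.filter fun w => absc w₃ - κ ≤ absc w).card := by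
    refine le_trans (Finset.card_le_card fun w hw => ?_) (Finset.card_union_le _ _)
    rw [Finset.mem_union, Finset.mem_filter, Finset.mem_filter]
    exact (hcover w hw).imp (fun h => ⟨hw, h⟩) fun h => ⟨hw, h⟩
  have c4 : (T.card : ℝ) ≤ (T.filter fun w => absc w ≤ absc w₁ + κ).card +
      (T.filter fun w => absc w₃ - κ ≤ absc w).card := by exact_mod_cast c3
  have e : κ / ((j.2.2 : ℝ) / Q ^ 2) = κ * Q ^ 2 / j.2.2 := by field_simp
  have h1 : 1 ≤ κ * Q ^ 2 / j.2.2 := by rwa [le_div_iff₀ hj0, one_mul]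
  rw [mul_div_assoc]
  linarith

/-- A rich line is nearly tangent to the graph at one of its points: among three points two
neighbours are at distance at most `√(2 * ε / a)`, and the line is their chord. -/
theorem IsRichLine.exists_slope_near (hj : IsRichLine P j) (H : QuadConvex G g a b)
    (hP : ∀ w ∈ P, NearPoint G M Q ε w) (hQ : 0 < Q) (hε : 0 ≤ ε) :
    ∃ w ∈ P, Incident j w ∧
      |-(j.2.1 : ℝ) / j.2.2 - g (absc w)| ≤ b * √(2 * ε / a) + 2 * ε * Q ^ 2 / j.2.2 := by
  have ha := H.pos
  have hb := H.pos'
  have hj0 := hj.pos_real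
  set κ := √(2 * ε / a) with hκ
  have hκ0 : 0 ≤ κ := Real.sqrt_nonneg _
  have hκ2 : a * κ ^ 2 = 2 * ε := mul_sqrt_sq ha hε
  obtain ⟨w, hw, w', hw', iw, iw', hlt, hle⟩ : ∃ w ∈ P, ∃ w' ∈ P, Incident j w ∧ Incident j w' ∧
      absc w < absc w' ∧ absc w' - absc w ≤ κ := by
    obtain ⟨w₁, h₁, w₂, h₂, w₃, h₃, i₁, i₂, i₃, h12, h23⟩ := hj.three
    have hg := (hP _ h₁).mul_gap_le H (hP _ h₂) (hP _ h₃) hj.pos i₁ i₂ i₃ h12 h23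
    by_cases hc : absc w₂ - absc w₁ ≤ κ
    · exact ⟨w₁, h₁, w₂, h₂, i₁, i₂, h12, hc⟩
    · refine ⟨w₂, h₂, w₃, h₃, i₂, i₃, h23, ?_⟩
      by_contra hc'
      push Not at hc hc'
      have : κ ^ 2 < (absc w₂ - absc w₁) * (absc w₃ - absc w₂) := by nlinarith
      nlinarith
  refine ⟨w, hw, iw, ?_⟩
  have hs := (hP _ hw).spacing (hP _ hw') hj.prim hj.pos iw iw' hlt.ne
  rw [abs_of_pos (sub_pos.2 hlt)] at hs
  have l1 := (hP _ hw).ordi_eq iw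
  have l2 := (hP _ hw').ordi_eq iw'
  have n1 := abs_le.1 (hP _ hw).near
  have n2 := abs_le.1 (hP _ hw').near
  have u1 := H.upper (absc w) (absc w')
  have u2 := H.lower (absc w) (absc w')
  set x := absc w
  set x' := absc w'
  set D := x' - x with hD
  have hD0 : 0 < D := sub_pos.2 hlt
  have u3 : 0 ≤ a * D ^ 2 := by positivity
  have hslope : -(j.2.1 : ℝ) / j.2.2 * D = ordi w' - ordi w := by
    rw [div_mul_eq_mul_div, div_eq_iff hj0.ne', hD]
    linarith
  have h1 : |(-(j.2.1 : ℝ) / j.2.2 - g x) * D| ≤ b * D ^ 2 + 2 * ε := by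
    rw [sub_mul, hslope, abs_le]
    constructor <;> linarith
  rw [abs_mul, abs_of_pos hD0] at h1
  refine le_of_mul_le_mul_right (h1.trans ?_) hD0
  have h2 : 2 * ε ≤ 2 * ε * Q ^ 2 / j.2.2 * D := by
    calc 2 * ε = 2 * ε * Q ^ 2 / j.2.2 * (j.2.2 / Q ^ 2) := by field_simp
      _ ≤ _ := by gcongr
  have h3 : b * D ^ 2 ≤ b * κ * D := by
    rw [sq, ← mul_assoc]; gcongr
  linarith

/-- Two parallel lines, both nearly tangent to the graph at a nearby point, are close together. -/
theorem abs_sub_le_of_slope_near (H : QuadConvex G g a b) {w w' : ℤ × ℤ × ℤ} {ρ : ℝ}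
    (hw : NearPoint G M Q ε w) (hw' : NearPoint G M Q ε w') (hj : 0 < j.2.2)
    (h1 : j'.2.1 = j.2.1) (h2 : j'.2.2 = j.2.2) (iw : Incident j w) (iw' : Incident j' w')
    (s : |-(j.2.1 : ℝ) / j.2.2 - g (absc w)| ≤ ρ)
    (s' : |-(j.2.1 : ℝ) / j.2.2 - g (absc w')| ≤ ρ) :
    |(j'.1 : ℝ) - j.1| ≤ j.2.2 * ((b / a ^ 2 + 1 / a) * ρ ^ 2 + 2 * ε) := by
  have ha := H.pos
  have hb := H.pos'
  have hj0 : (0 : ℝ) < j.2.2 := by exact_mod_cast hj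
  have l1 := hw.ordi_eq iw
  have l2 := hw'.ordi_eq iw'
  rw [h1, h2] at l2
  have n1 := abs_le.1 hw.near
  have n2 := abs_le.1 hw'.near
  have u1 := H.upper (absc w) (absc w')
  have u2 := H.lower (absc w) (absc w')
  have u4 := H.abs_lower (absc w) (absc w')
  set x := absc w
  set x' := absc w'
  set σ := -(j.2.1 : ℝ) / j.2.2 with hσ
  have hσ' : (j.2.1 : ℝ) = -(σ * j.2.2) := by rw [hσ]; field_simp
  have hρ : 0 ≤ ρ := (abs_nonneg _).trans s
  have hd : |x' - x| ≤ ρ / a := by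
    have : |g x' - g x| ≤ 2 * ρ := by
      have s1 := abs_le.1 s
      have s2 := abs_le.1 s'
      rw [abs_le]; constructor <;> linarith
    rw [le_div_iff₀ ha]
    linarith
  have hsq : (x' - x) ^ 2 ≤ ρ ^ 2 / a ^ 2 := by
    rw [← sq_abs, ← div_pow]; gcongr
  have u3 : 0 ≤ a * (x' - x) ^ 2 := by positivity
  have u5 : b * (x' - x) ^ 2 ≤ b / a ^ 2 * ρ ^ 2 := by
    calc b * (x' - x) ^ 2 ≤ b * (ρ ^ 2 / a ^ 2) := by gcongr
      _ = _ := by ring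
  have u6 : |(σ - g x) * (x' - x)| ≤ 1 / a * ρ ^ 2 := by
    rw [abs_mul]
    calc |σ - g x| * |x' - x| ≤ ρ * (ρ / a) := by gcongr
      _ = _ := by ring
  have u7 := abs_le.1 u6
  have e : (j'.1 : ℝ) - j.1 = j.2.2 * (σ * (x' - x) - (ordi w' - ordi w)) := by
    rw [hσ'] at l1 l2
    linarith
  rw [e, abs_mul, abs_of_pos hj0]
  gcongr
  rw [abs_le]
  constructor <;> linarith

end RichLines

/-! ### Counting primitive points -/

theorem QuadConvex.exists_slope_bound {G g : ℝ → ℝ} {a b : ℝ} (H : QuadConvex G g a b) (M : ℝ) :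
    ∃ M' : ℝ, 0 ≤ M' ∧ ∀ Q ε : ℝ, 1 ≤ Q → 0 ≤ ε → ε * Q ^ 2 ≤ 1 →
      ∀ P : Finset (ℤ × ℤ × ℤ), (∀ w ∈ P, NearPoint G M Q ε w) →
        ∀ j, IsRichLine P j → |(j.2.1 : ℝ)| ≤ M' * j.2.2 := by
  have ha := H.pos
  have hb := H.pos'
  refine ⟨|g 0| + 2 * b * |M| + b * √(2 / a) + 2, by positivity, fun Q ε hQ hε hεQ P hP j hj => ?_⟩
  have hj0 := hj.pos_real
  have hj1 : (1 : ℝ) ≤ j.2.2 := by exact_mod_cast hj.pos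
  obtain ⟨w, hw, iw, hs⟩ := hj.exists_slope_near H hP (by linarith) hε
  have hε1 : ε ≤ 1 := (le_mul_of_one_le_right hε (one_le_pow₀ hQ)).trans hεQ
  have h1 : √(2 * ε / a) ≤ √(2 / a) := by
    apply Real.sqrt_le_sqrt
    gcongr
    linarith
  have h2 : 2 * ε * Q ^ 2 / j.2.2 ≤ 2 := by
    rw [div_le_iff₀ hj0]; linarith
  have h3 : |g (absc w)| ≤ |g 0| + 2 * b * |M| := by
    have h4 := H.abs_upper 0 (absc w)
    have h5 : |absc w - 0| ≤ |M| := by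
      rw [sub_zero]
      exact (hP w hw).absc_le.trans (le_abs_self M)
    have h6 : 2 * b * |absc w - 0| ≤ 2 * b * |M| := by gcongr
    have h7 := abs_sub_abs_le_abs_sub (g (absc w)) (g 0)
    linarith
  have h4 := abs_sub_abs_le_abs_sub (-(j.2.1 : ℝ) / j.2.2) (g (absc w))
  have h5 : b * √(2 * ε / a) ≤ b * √(2 / a) := by gcongr
  have h6 : |-(j.2.1 : ℝ) / j.2.2| ≤ |g 0| + 2 * b * |M| + b * √(2 / a) + 2 := by linarith
  rwa [abs_div, abs_neg, abs_of_pos hj0, div_le_iff₀ hj0] at h6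

/-- For `ε Q ^ 2` small, a rich line is determined by its direction: parallel rich lines have
integral constant terms that differ by less than `1`. -/
theorem QuadConvex.exists_parallel_eq {G g : ℝ → ℝ} {a b : ℝ} (H : QuadConvex G g a b) (M : ℝ) :
    ∃ c : ℝ, 0 < c ∧ 2 * c < 1 ∧ ∀ Q ε : ℝ, 1 ≤ Q → 0 ≤ ε → ε * Q ^ 2 ≤ c →
      ∀ P : Finset (ℤ × ℤ × ℤ), (∀ w ∈ P, NearPoint G M Q ε w) →
        ∀ j j', IsRichLine P j → IsRichLine P j' → j.2 = j'.2 → j = j' := by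
  have ha := H.pos
  have hb := H.pos'
  set s := √(2 / a) with hs
  have hs0 : 0 ≤ s := Real.sqrt_nonneg _
  set K := (b / a ^ 2 + 1 / a) * (4 * b ^ 2 * s / a + 8) + 2 * s with hK
  have hK0 : 0 ≤ K := by positivity
  refine ⟨1 / (K + 3), by positivity, ?_, fun Q ε hQ hε hεQ P hP j j' hj hj' hjj => ?_⟩
  · rw [mul_one_div, div_lt_one (by positivity)]; linarith
  set c := 1 / (K + 3) with hc
  have hc0 : 0 < c := by positivity
  have hcK : c * (K + 3) = 1 := by rw [hc]; field_simp
  have hc1 : c ≤ 1 := by rw [hc, div_le_one (by positivity)]; linarith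
  have hQ0 : 0 < Q := by linarith
  have hj0 := hj.pos_real
  have hj1 : (1 : ℝ) ≤ j.2.2 := by exact_mod_cast hj.pos
  obtain ⟨w, hw, iw, sw⟩ := hj.exists_slope_near H hP hQ0 hε
  obtain ⟨w', hw', iw', sw'⟩ := hj'.exists_slope_near H hP hQ0 hε
  rw [← hjj] at sw'
  have hY := hj.height_le H hP hQ0
  set κ := √(2 * ε / a) with hκ
  have hκ0 : 0 ≤ κ := Real.sqrt_nonneg _
  have hκ2 : a * κ ^ 2 = 2 * ε := mul_sqrt_sq ha hε
  have hε1 : ε ≤ 1 := (le_mul_of_one_le_right hε (one_le_pow₀ hQ)).trans (hεQ.trans hc1)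
  have hκs : κ ≤ s := by
    apply Real.sqrt_le_sqrt
    gcongr
    linarith
  have key := abs_sub_le_of_slope_near H (hP w hw) (hP w' hw') hj.pos
    (by rw [hjj]) (by rw [hjj]) iw iw' sw sw'
  generalize (j.2.2 : ℝ) = h at hj0 hj1 hY key
  -- each term of the bound is at most a multiple of `ε Q ^ 2`, as `h ≤ κ Q ^ 2`
  have e1 : h * (2 * ε) ≤ c * (2 * s) := by
    calc h * (2 * ε) ≤ κ * Q ^ 2 * (2 * ε) := by gcongr
      _ = 2 * κ * (ε * Q ^ 2) := by ring
      _ ≤ 2 * s * c := by gcongr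
      _ = _ := by ring
  have e2 : h * (b * κ + 2 * ε * Q ^ 2 / h) ^ 2 ≤ c * (4 * b ^ 2 * s / a + 8) := by
    have e3 : (b * κ + 2 * ε * Q ^ 2 / h) ^ 2 ≤
        2 * (b * κ) ^ 2 + 2 * (2 * ε * Q ^ 2 / h) ^ 2 := by
      nlinarith [sq_nonneg (b * κ - 2 * ε * Q ^ 2 / h)]
    have e4 : h * (2 * (b * κ) ^ 2) ≤ c * (4 * b ^ 2 * s / a) := by
      calc h * (2 * (b * κ) ^ 2) ≤ κ * Q ^ 2 * (2 * (b * κ) ^ 2) := by gcongr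
        _ = 2 * b ^ 2 * κ * Q ^ 2 * (a * κ ^ 2) / a := by field_simp
        _ = 4 * b ^ 2 * κ / a * (ε * Q ^ 2) := by rw [hκ2]; ring
        _ ≤ 4 * b ^ 2 * s / a * c := by gcongr
        _ = _ := by ring
    have e5 : h * (2 * (2 * ε * Q ^ 2 / h) ^ 2) ≤ c * 8 := by
      calc h * (2 * (2 * ε * Q ^ 2 / h) ^ 2) = 8 * (ε * Q ^ 2) ^ 2 / h := by field_simp; ring
        _ ≤ 8 * (ε * Q ^ 2) ^ 2 := div_le_self (by positivity) hj1
        _ ≤ 8 * c ^ 2 := by gcongr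
        _ ≤ c * 8 := by nlinarith
    calc h * (b * κ + 2 * ε * Q ^ 2 / h) ^ 2
        ≤ h * (2 * (b * κ) ^ 2 + 2 * (2 * ε * Q ^ 2 / h) ^ 2) := by gcongr
      _ ≤ _ := by linarith
  have e6 : |(j'.1 : ℝ) - j.1| < 1 := by
    refine lt_of_le_of_lt key ?_
    calc h * ((b / a ^ 2 + 1 / a) * (b * κ + 2 * ε * Q ^ 2 / h) ^ 2 + 2 * ε)
        = (b / a ^ 2 + 1 / a) * (h * (b * κ + 2 * ε * Q ^ 2 / h) ^ 2) + h * (2 * ε) := by ring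
      _ ≤ (b / a ^ 2 + 1 / a) * (c * (4 * b ^ 2 * s / a + 8)) + c * (2 * s) := by gcongr
      _ = c * K := by rw [hK]; ring
      _ < 1 := by nlinarith
  have e7 : j'.1 - j.1 = 0 := Int.abs_lt_one_iff.1 (by exact_mod_cast e6)
  exact Prod.ext (by omega) hjj

theorem card_int_abs_le (S : Finset ℤ) {B : ℝ} (hB : 0 ≤ B) (h : ∀ k ∈ S, |(k : ℝ)| ≤ B) :
    (S.card : ℝ) ≤ 2 * B + 1 := by
  have h1 : S ⊆ Finset.Icc (-⌊B⌋) ⌊B⌋ := by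
    intro k hk
    have h2 := abs_le.1 (h k hk)
    rw [Finset.mem_Icc]
    refine ⟨?_, Int.le_floor.2 h2.2⟩
    have : -k ≤ ⌊B⌋ := Int.le_floor.2 (by push_cast; linarith)
    omega
  have h2 := Finset.card_le_card h1
  rw [Int.card_Icc] at h2
  have h3 : 0 ≤ ⌊B⌋ := Int.floor_nonneg.2 hB
  have h4 : (S.card : ℤ) ≤ 2 * ⌊B⌋ + 1 := by omega
  have h5 : (S.card : ℝ) ≤ 2 * ⌊B⌋ + 1 := by exact_mod_cast h4
  linarith [Int.floor_le B]

/-- At height `k` there are `O(k)` directions of bounded slope, each carrying weight `4 * Y / k`. -/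
theorem sum_div_height_le {L : Finset (ℤ × ℤ × ℤ)} {M' Y : ℝ} (hM' : 0 ≤ M') (hY : 0 ≤ Y)
    (hinj : ∀ j ∈ L, ∀ j' ∈ L, j.2 = j'.2 → j = j')
    (hpos : ∀ j ∈ L, 0 < j.2.2) (hle : ∀ j ∈ L, (j.2.2 : ℝ) ≤ Y)
    (hslope : ∀ j ∈ L, |(j.2.1 : ℝ)| ≤ M' * j.2.2) :
    ∑ j ∈ L, 4 * Y / j.2.2 ≤ 4 * (2 * M' + 1) * Y ^ 2 := by
  classical
  have hmaps : ∀ j ∈ L, j.2.2 ∈ Finset.Icc (1 : ℤ) ⌊Y⌋ := fun j hj =>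
    Finset.mem_Icc.2 ⟨hpos j hj, Int.le_floor.2 (hle j hj)⟩
  rw [← Finset.sum_fiberwise_of_maps_to hmaps]
  have hfib : ∀ k ∈ Finset.Icc (1 : ℤ) ⌊Y⌋,
      ∑ j ∈ L with j.2.2 = k, 4 * Y / (j.2.2 : ℝ) ≤ 4 * (2 * M' + 1) * Y := by
    intro k hk
    have hk1 : (1 : ℝ) ≤ k := by exact_mod_cast (Finset.mem_Icc.1 hk).1
    have hk0 : (0 : ℝ) < k := by linarith
    have h1 : ∑ j ∈ L with j.2.2 = k, 4 * Y / (j.2.2 : ℝ) =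
        ((L.filter fun j => j.2.2 = k).card : ℝ) * (4 * Y / k) := by
      rw [Finset.sum_congr rfl fun j hj => by rw [(Finset.mem_filter.1 hj).2], Finset.sum_const,
        nsmul_eq_mul]
    have h2 : ((L.filter fun j => j.2.2 = k).card : ℝ) ≤ 2 * (M' * k) + 1 := by
      have h3 : (L.filter fun j => j.2.2 = k).card =
          ((L.filter fun j => j.2.2 = k).image fun j => j.2.1).card := by
        refine (Finset.card_image_of_injOn ?_).symm
        intro j hj j' hj' hjj
        rw [Finset.mem_coe, Finset.mem_filter] at hj hj'
        exact hinj j hj.1 j' hj'.1 (Prod.ext hjj (hj.2.trans hj'.2.symm))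
      rw [h3]
      refine card_int_abs_le _ (by positivity) fun m hm => ?_
      obtain ⟨j, hj, rfl⟩ := Finset.mem_image.1 hm
      rw [Finset.mem_filter] at hj
      rw [← hj.2]
      exact hslope j hj.1
    rw [h1]
    calc ((L.filter fun j => j.2.2 = k).card : ℝ) * (4 * Y / k)
        ≤ ((2 * M' + 1) * k) * (4 * Y / k) := by
          gcongr
          linarith
      _ = _ := by field_simp
  refine (Finset.sum_le_sum hfib).trans ?_
  rw [Finset.sum_const, nsmul_eq_mul, Int.card_Icc]
  have h0 : 0 ≤ ⌊Y⌋ := Int.floor_nonneg.2 hY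
  have h1 : ((⌊Y⌋ + 1 - 1).toNat : ℝ) ≤ Y := by
    have : (((⌊Y⌋ + 1 - 1).toNat : ℤ) : ℝ) = (⌊Y⌋ : ℝ) := by
      congr 1
      omega
    rw [Int.cast_natCast] at this
    rw [this]
    exact Int.floor_le Y
  calc ((⌊Y⌋ + 1 - 1).toNat : ℝ) * (4 * (2 * M' + 1) * Y) ≤ Y * (4 * (2 * M' + 1) * Y) := by gcongr
    _ = _ := by ring

/-- There are `O(Q + ε Q ^ 4)` primitive points of denominator at most `Q` within `ε` of the graph.
Cells of length `O(1 / Q)` holding at most two points account for `O(Q)`; the points of any other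
cell are collinear and are counted along rich lines. -/
theorem QuadConvex.exists_card_nearPoint_le {G g : ℝ → ℝ} {a b : ℝ} (H : QuadConvex G g a b)
    {M : ℝ} (hM : 0 ≤ M) :
    ∃ C c : ℝ, 0 < C ∧ 0 < c ∧ ∀ Q ε : ℝ, 1 ≤ Q → 0 ≤ ε → ε * Q ^ 2 ≤ c →
      ∀ P : Finset (ℤ × ℤ × ℤ), (∀ w ∈ P, NearPoint G M Q ε w) →
        (P.card : ℝ) ≤ C * (Q + ε * Q ^ 4) := by
  classical
  have ha := H.pos
  have hb := H.pos'
  obtain ⟨M', hM', hslope⟩ := H.exists_slope_bound M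
  obtain ⟨c, hc, hc2, hpar⟩ := H.exists_parallel_eq M
  set c₀ := 1 / (2 * b + 5) with hc₀
  have hc₀0 : 0 < c₀ := by positivity
  have hc₀e : c₀ * (2 * b + 5) = 1 := by rw [hc₀]; field_simp
  have hc₀1 : c₀ ≤ 1 := by rw [hc₀, div_le_one (by positivity)]; linarith
  refine ⟨2 * (2 * (M / c₀ + 1) + 1) + 8 * (2 * M' + 1) / a, c, by positivity, hc,
    fun Q ε hQ hε hεQ P hP => ?_⟩
  have hQ0 : 0 < Q := by linarith
  have hεQ' : 2 * ε * Q ^ 2 < 1 := by linarith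
  have hinj : ∀ w ∈ P, ∀ w' ∈ P, absc w = absc w' → w = w' := fun w hw w' hw' he =>
    (hP w hw).eq_of_absc_eq (hP w' hw') hεQ' he
  set L := c₀ / Q with hL
  have hL0 : 0 < L := by positivity
  have hLsmall : Q ^ 3 * (2 * L * (b * L ^ 2 + 2 * ε)) < 1 := by
    have e : Q ^ 3 * (2 * L * (b * L ^ 2 + 2 * ε)) = 2 * c₀ * (b * c₀ ^ 2 + 2 * (ε * Q ^ 2)) := by
      rw [hL]; field_simp
    rw [e]
    have h1 : b * c₀ ^ 2 ≤ b := by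
      have : c₀ ^ 2 ≤ 1 := by nlinarith
      nlinarith
    have h2 : b * c₀ ^ 2 + 2 * (ε * Q ^ 2) ≤ b + 1 := by linarith
    calc 2 * c₀ * (b * c₀ ^ 2 + 2 * (ε * Q ^ 2)) ≤ 2 * c₀ * (b + 1) := by gcongr
      _ < 1 := by linarith
  -- cells so short that any three points in one cell have an integral determinant below `1`
  set cell : ℤ × ℤ × ℤ → ℤ := fun w => ⌊absc w / L⌋ with hcell
  have hcellL : ∀ w w', cell w = cell w' → |absc w' - absc w| ≤ L := by
    intro w w' hww
    have h1 := Int.abs_sub_lt_one_of_floor_eq_floor hww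
    rw [← sub_div, abs_div, abs_of_pos hL0, div_lt_one hL0, abs_sub_comm] at h1
    exact h1.le
  set P₁ := P.filter fun w => (P.filter fun w' => cell w' = cell w).card ≤ 2 with hP₁
  set P₂ := P.filter fun w => ¬ (P.filter fun w' => cell w' = cell w).card ≤ 2 with hP₂
  have hsplit : P.card = P₁.card + P₂.card :=
    (Finset.card_filter_add_card_filter_not _).symm
  have hcard₁ : (P₁.card : ℝ) ≤ 2 * (2 * (M / c₀ + 1) + 1) * Q := by
    have h1 : P₁.card ≤ 2 * (P₁.image cell).card := by
      refine Finset.card_le_mul_card_image P₁ 2 fun k hk => ?_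
      obtain ⟨w, hw, rfl⟩ := Finset.mem_image.1 hk
      refine le_trans (Finset.card_le_card ?_) (Finset.mem_filter.1 hw).2
      exact Finset.filter_subset_filter _ (Finset.filter_subset _ _)
    have h2 : ((P₁.image cell).card : ℝ) ≤ 2 * (M / L + 1) + 1 := by
      refine card_int_abs_le _ (by positivity) fun k hk => ?_
      obtain ⟨w, hw, rfl⟩ := Finset.mem_image.1 hk
      have h3 := abs_le.1 (hP w (Finset.mem_filter.1 hw).1).absc_le
      have h4 := Int.floor_le (absc w / L)
      have h5 := Int.lt_floor_add_one (absc w / L)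
      have h6 : absc w / L ≤ M / L := by gcongr; exact h3.2
      have h7 : -(M / L) ≤ absc w / L := by rw [← neg_div]; gcongr; exact h3.1
      rw [abs_le]
      simp only [hcell]
      constructor <;> linarith
    have h3 : (P₁.card : ℝ) ≤ 2 * (P₁.image cell).card := by exact_mod_cast h1
    have h4 : M / L = M / c₀ * Q := by rw [hL]; field_simp
    rw [h4] at h2
    nlinarith
  -- every other point lies on a rich line
  have hline : ∀ w ∈ P₂, ∃ j, IsRichLine P j ∧ Incident j w := by
    intro w hw
    obtain ⟨hwP, hw2⟩ := Finset.mem_filter.1 hw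
    push Not at hw2
    obtain ⟨w₁, h₁, w₂, h₂, w₃, h₃, h12, h23⟩ := exists_absc_lt_lt hw2
      (fun u hu v hv => hinj u (Finset.mem_filter.1 hu).1 v (Finset.mem_filter.1 hv).1)
    obtain ⟨h₁P, h₁c⟩ := Finset.mem_filter.1 h₁
    obtain ⟨h₂P, h₂c⟩ := Finset.mem_filter.1 h₂
    obtain ⟨h₃P, h₃c⟩ := Finset.mem_filter.1 h₃
    have hne : w₁.1 * w₂.2.1 - w₁.2.1 * w₂.1 ≠ 0 := by
      intro h0
      have h4 := (hP w₁ h₁P).absc_sub (hP w₂ h₂P)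
      rw [mul_comm w₂.1, h0, Int.cast_zero, zero_div] at h4
      linarith
    obtain ⟨j, hj, hj0, hinc⟩ := exists_line hne
    have hon : ∀ z ∈ P, cell z = cell w → Incident j z := fun z hz hzc =>
      hinc z ((hP w₁ h₁P).det3_eq_zero H (hP w₂ h₂P) (hP z hz)
        (hcellL _ _ (h₁c.trans h₂c.symm)) (hcellL _ _ (h₁c.trans hzc.symm)) hLsmall)
    exact ⟨j, ⟨hj, hj0, w₁, h₁P, w₂, h₂P, w₃, h₃P, hon _ h₁P h₁c, hon _ h₂P h₂c, hon _ h₃P h₃c,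
      h12, h23⟩, hon w hwP rfl⟩
  choose! line hrich hon using hline
  set Y := √(2 * ε / a) * Q ^ 2 with hY
  have hY0 : 0 ≤ Y := by positivity
  have hcard₂ : (P₂.card : ℝ) ≤ 8 * (2 * M' + 1) / a * (ε * Q ^ 4) := by
    have hrichL : ∀ j ∈ P₂.image line, IsRichLine P j := by
      intro j hj
      obtain ⟨w, hw, rfl⟩ := Finset.mem_image.1 hj
      exact hrich w hw
    have h1 := Finset.card_eq_sum_card_fiberwise (f := line) (s := P₂) (t := P₂.image line)
      (fun w hw => Finset.mem_image_of_mem _ hw)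
    have h2 : (P₂.card : ℝ) ≤ ∑ j ∈ P₂.image line, 4 * Y / j.2.2 := by
      rw [h1]
      push_cast
      refine Finset.sum_le_sum fun j hj => ?_
      refine (hrichL j hj).card_le H hP hQ0 hε hεQ' fun w hw => ?_
      obtain ⟨hw2, rfl⟩ := Finset.mem_filter.1 hw
      exact ⟨(Finset.mem_filter.1 hw2).1, hon w hw2⟩
    have h3 := sum_div_height_le (L := P₂.image line) hM' hY0
      (fun j hj j' hj' => hpar Q ε hQ hε hεQ P hP j j' (hrichL j hj) (hrichL j' hj'))
      (fun j hj => (hrichL j hj).pos) (fun j hj => (hrichL j hj).height_le H hP hQ0)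
      (fun j hj => hslope Q ε hQ hε (by linarith) P hP j (hrichL j hj))
    have h4 : Y ^ 2 = 2 * ε / a * Q ^ 4 := by
      rw [hY, mul_pow, Real.sq_sqrt (by positivity)]; ring
    refine (h2.trans h3).trans (le_of_eq ?_)
    rw [h4]; ring
  have h5 : (P.card : ℝ) = P₁.card + P₂.card := by exact_mod_cast hsplit
  have h6 : 0 ≤ 2 * (2 * (M / c₀ + 1) + 1) * (ε * Q ^ 4) := by positivity
  have h7 : 0 ≤ 8 * (2 * M' + 1) / a * Q := by positivity
  rw [h5]
  linarith

/-! ### Counting all points -/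

theorem sum_inv_pow_four_le (n : ℕ) :
    ∑ i ∈ Finset.range n, 1 / ((i : ℝ) + 1) ^ 4 ≤ 3 - 2 / ((n : ℝ) + 1) := by
  induction n with
  | zero => simp; norm_num
  | succ n ih =>
    rw [Finset.sum_range_succ]
    push_cast
    have hn : (0 : ℝ) ≤ n := Nat.cast_nonneg n
    have h1 : 1 / ((n : ℝ) + 1) ^ 4 ≤ 2 / ((n : ℝ) + 1) - 2 / ((n : ℝ) + 1 + 1) := by
      rw [div_sub_div _ _ (by positivity) (by positivity), div_le_div_iff₀ (by positivity)
        (by positivity)]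
      have h2 : 1 * ((n : ℝ) + 1 + 1) ≤ 2 * ((n : ℝ) + 1) ^ 3 := by
        nlinarith [mul_nonneg hn hn, mul_nonneg (mul_nonneg hn hn) hn]
      nlinarith [mul_le_mul_of_nonneg_right h2 (show 0 ≤ (n : ℝ) + 1 by positivity)]
    linarith

theorem sum_inv_le_one_add_log (n : ℕ) :
    ∑ i ∈ Finset.range n, 1 / ((i : ℝ) + 1) ≤ 1 + Real.log n := by
  have h := harmonic_le_one_add_log n
  rw [harmonic] at h
  push_cast at h
  simpa only [one_div] using h

/-- For `v = (q, p)`, the vertical distance from the point of the graph of `G` above `p / q` to the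
nearest rational point with the same abscissa and denominator `q`. -/
noncomputable def nearness (G : ℝ → ℝ) (v : ℤ × ℤ) : ℝ :=
  distNearestInt (v.1 * G (v.2 / v.1)) / v.1

theorem card_pairs_le (S : Finset (ℤ × ℤ)) {M : ℝ} (hM : 0 ≤ M) {N : ℕ} (hN : 1 ≤ N)
    (hS : ∀ v ∈ S, 0 < v.1 ∧ v.1 ≤ N ∧ |(v.2 : ℝ)| ≤ M * v.1) :
    (S.card : ℝ) ≤ (2 * M + 1) * (N : ℝ) ^ 2 := by
  classical
  have hN1 : (1 : ℝ) ≤ N := by exact_mod_cast hN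
  have h1 : S ⊆ Finset.Icc (1 : ℤ) N ×ˢ S.image Prod.snd := by
    intro v hv
    have := hS v hv
    exact Finset.mem_product.2 ⟨Finset.mem_Icc.2 ⟨this.1, this.2.1⟩, Finset.mem_image_of_mem _ hv⟩
  have h2 := Finset.card_le_card h1
  rw [Finset.card_product, Int.card_Icc] at h2
  have h3 : ((S.image Prod.snd).card : ℝ) ≤ 2 * (M * N) + 1 := by
    refine card_int_abs_le _ (by positivity) fun k hk => ?_
    obtain ⟨v, hv, rfl⟩ := Finset.mem_image.1 hk
    obtain ⟨-, h4, h5⟩ := hS v hv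
    refine h5.trans ?_
    gcongr
    exact_mod_cast h4
  have h4 : (S.card : ℝ) ≤ N * (S.image Prod.snd).card := by
    have : ((N : ℤ) + 1 - 1).toNat = N := by omega
    rw [this] at h2
    exact_mod_cast h2
  calc (S.card : ℝ) ≤ N * (S.image Prod.snd).card := h4
    _ ≤ N * (2 * (M * N) + 1) := by gcongr
    _ ≤ _ := by nlinarith

/-- The count of not necessarily reduced points: writing each as `d` times a primitive one, the sum
of `N / d` over `d` produces the logarithm. For `ε N ^ 2` large the bound is trivial. -/
theorem QuadConvex.exists_card_nearness_le {G g : ℝ → ℝ} {a b : ℝ} (H : QuadConvex G g a b)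
    {M : ℝ} (hM : 0 ≤ M) :
    ∃ K : ℝ, 0 < K ∧ ∀ N : ℕ, 1 ≤ N → ∀ ε : ℝ, 0 ≤ ε → ∀ S : Finset (ℤ × ℤ),
      (∀ v ∈ S, 0 < v.1 ∧ v.1 ≤ N ∧ |(v.2 : ℝ)| ≤ M * v.1 ∧ nearness G v ≤ ε) →
        (S.card : ℝ) ≤ K * (N * (1 + Real.log N) + ε * (N : ℝ) ^ 4) := by
  classical
  obtain ⟨C, c, hC, hc, hcount⟩ := H.exists_card_nearPoint_le hM
  refine ⟨3 * C + (2 * M + 1) / c, by positivity, fun N hN ε hε S hS => ?_⟩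
  have hN1 : (1 : ℝ) ≤ N := by exact_mod_cast hN
  have hN0 : (0 : ℝ) < N := by linarith
  have hlog : 0 ≤ Real.log N := Real.log_nonneg hN1
  rcases lt_or_ge c (ε * (N : ℝ) ^ 2) with hbig | hsmall
  · have h1 := card_pairs_le S hM hN fun v hv => ⟨(hS v hv).1, (hS v hv).2.1, (hS v hv).2.2.1⟩
    have h2 : (2 * M + 1) * (N : ℝ) ^ 2 ≤ (2 * M + 1) / c * (ε * (N : ℝ) ^ 4) := by
      calc (2 * M + 1) * (N : ℝ) ^ 2 = (2 * M + 1) / c * (N : ℝ) ^ 2 * c := by field_simp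
        _ ≤ (2 * M + 1) / c * (N : ℝ) ^ 2 * (ε * (N : ℝ) ^ 2) := by gcongr
        _ = _ := by ring
    have h3 : 0 ≤ 3 * C * (N * (1 + Real.log N) + ε * (N : ℝ) ^ 4) := by positivity
    have h4 : 0 ≤ (2 * M + 1) / c * (N * (1 + Real.log N)) := by positivity
    linarith
  · have hdec : ∀ v : ℤ × ℤ, ∃ (d : ℤ) (w : ℤ × ℤ × ℤ), v.1 ≠ 0 → 0 < d ∧ IsPrimitive w ∧
        v.1 = d * w.1 ∧ v.2 = d * w.2.1 ∧ round (v.1 * G (v.2 / v.1)) = d * w.2.2 := by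
      intro v
      by_cases hv : v.1 = 0
      · exact ⟨0, 0, fun h => absurd hv h⟩
      · obtain ⟨d, w, h⟩ := exists_isPrimitive v.1 v.2 (round (v.1 * G (v.2 / v.1))) hv
        exact ⟨d, w, fun _ => h⟩
    choose d w hdw using hdec
    have hprop : ∀ v ∈ S, 0 < d v ∧ 0 < (w v).1 ∧ d v ≤ N := by
      intro v hv
      obtain ⟨h1, h2, -, -⟩ := hS v hv
      obtain ⟨h3, -, h4, -, -⟩ := hdw v h1.ne'
      have h5 : 0 < (w v).1 := by
        rw [h4] at h1
        exact pos_of_mul_pos_right h1 h3.le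
      refine ⟨h3, h5, ?_⟩
      nlinarith
    have hfib : ∀ i ∈ Finset.range N, ((S.filter fun v => d v = i + 1).card : ℝ) ≤
        C * (N * (1 / ((i : ℝ) + 1)) + ε * (N : ℝ) ^ 4 * (1 / ((i : ℝ) + 1) ^ 4)) := by
      intro i hi
      have hiN : (i : ℝ) + 1 ≤ N := by exact_mod_cast Finset.mem_range.1 hi
      have hi0 : (0 : ℝ) < (i : ℝ) + 1 := by positivity
      have hcard : ((S.filter fun v => d v = i + 1).image w).card =
          (S.filter fun v => d v = i + 1).card := by
        refine Finset.card_image_of_injOn fun v hv v' hv' hww => ?_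
        rw [Finset.mem_coe, Finset.mem_filter] at hv hv'
        obtain ⟨-, -, e1, e2, -⟩ := hdw v (hS v hv.1).1.ne'
        obtain ⟨-, -, e1', e2', -⟩ := hdw v' (hS v' hv'.1).1.ne'
        refine Prod.ext ?_ ?_
        · rw [e1, e1', hv.2, hv'.2, hww]
        · rw [e2, e2', hv.2, hv'.2, hww]
      rw [← hcard]
      have hQ1 : 1 ≤ (N : ℝ) / (i + 1) := by rwa [le_div_iff₀ hi0, one_mul]
      have hεQ : ε * ((N : ℝ) / (i + 1)) ^ 2 ≤ c := by
        refine le_trans ?_ hsmall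
        gcongr
        exact div_le_self hN0.le (by linarith [Nat.cast_nonneg (α := ℝ) i])
      refine (hcount _ ε hQ1 hε hεQ _ fun u hu => ?_).trans (le_of_eq ?_)
      · obtain ⟨v, hv, rfl⟩ := Finset.mem_image.1 hu
        obtain ⟨hv, hvd⟩ := Finset.mem_filter.1 hv
        obtain ⟨h1, h2, h3, h4⟩ := hS v hv
        obtain ⟨h5, h6, h7, h8, h9⟩ := hdw v h1.ne'
        have hw0 : (0 : ℝ) < (w v).1 := by exact_mod_cast (hprop v hv).2.1
        have hd0 : (0 : ℝ) < d v := by exact_mod_cast h5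
        have hv0 : (0 : ℝ) < v.1 := by exact_mod_cast h1
        have h7' : (v.1 : ℝ) = d v * (w v).1 := by exact_mod_cast h7
        have h8' : (v.2 : ℝ) = d v * (w v).2.1 := by exact_mod_cast h8
        have h9' : (round (v.1 * G (v.2 / v.1)) : ℝ) = d v * (w v).2.2 := by exact_mod_cast h9
        have habsc : absc (w v) = v.2 / v.1 := by
          rw [absc, h7', h8']; field_simp
        have hordi : ordi (w v) = round (v.1 * G (v.2 / v.1)) / v.1 := by
          rw [ordi, h9', h7']; field_simp
        refine ⟨h6, (hprop v hv).2.1, ?_, ?_, ?_⟩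
        · rw [le_div_iff₀ hi0]
          have : (d v : ℝ) = i + 1 := by rw [hvd]; push_cast; ring
          rw [← this, mul_comm, ← h7']
          exact_mod_cast h2
        · rw [habsc, abs_div, abs_of_pos hv0, div_le_iff₀ hv0]
          exact h3
        · refine le_trans (le_of_eq ?_) h4
          have e : G (v.2 / v.1) - round (v.1 * G (v.2 / v.1)) / v.1 =
              (v.1 * G (v.2 / v.1) - round (v.1 * G (v.2 / v.1))) / v.1 := by field_simp
          rw [habsc, hordi, nearness, distNearestInt, abs_sub_comm, e, abs_div, abs_of_pos hv0]
      · field_simp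
    have hmaps : ∀ v ∈ S, (d v - 1).toNat ∈ Finset.range N := fun v hv => by
      have := hprop v hv
      rw [Finset.mem_range]
      omega
    have hcard : (S.card : ℝ) = ∑ i ∈ Finset.range N, ((S.filter fun v => d v = i + 1).card : ℝ) := by
      rw [Finset.card_eq_sum_card_fiberwise hmaps]
      push_cast
      refine Finset.sum_congr rfl fun i _ => ?_
      congr 2
      refine Finset.filter_congr fun v hv => ?_
      have := hprop v hv
      omega
    rw [hcard]
    refine (Finset.sum_le_sum hfib).trans ?_
    rw [← Finset.mul_sum, Finset.sum_add_distrib, ← Finset.mul_sum, ← Finset.mul_sum]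
    have h1 := sum_inv_le_one_add_log N
    have h2 : ∑ i ∈ Finset.range N, 1 / ((i : ℝ) + 1) ^ 4 ≤ 3 :=
      (sum_inv_pow_four_le N).trans (by
        have : 0 ≤ 2 / ((N : ℝ) + 1) := by positivity
        linarith)
    have h3 : 0 ≤ (2 * M + 1) / c * (N * (1 + Real.log N) + ε * (N : ℝ) ^ 4) := by positivity
    have h4 : 0 ≤ C * (N * (1 + Real.log N)) := by positivity
    calc C * (N * ∑ i ∈ Finset.range N, 1 / ((i : ℝ) + 1) +
          ε * (N : ℝ) ^ 4 * ∑ i ∈ Finset.range N, 1 / ((i : ℝ) + 1) ^ 4)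
        ≤ C * (N * (1 + Real.log N) + ε * (N : ℝ) ^ 4 * 3) := by gcongr
      _ ≤ _ := by linarith

/-! ### Summing the exceptional terms -/

/-- Dyadic layers: linear growth of the counting function of `e` bounds the sum of
`1 / √(e + τ ^ 2)`, the constant part `A` weighing at the bottom layer `e ≈ τ ^ 2` and the linear
part `B` at the top layer. -/
theorem sum_inv_sqrt_layer_le {ι : Type*} (S : Finset ι) (e : ι → ℝ) {A B τ : ℝ}
    (he : ∀ i ∈ S, 0 ≤ e i) (hB : 0 ≤ B) (hτ : 0 < τ)
    (hcount : ∀ ε : ℝ, 0 ≤ ε → ((S.filter fun i => e i ≤ ε).card : ℝ) ≤ A + B * ε) (R : ℕ) :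
    ∑ i ∈ S with e i ≤ (2 ^ R * τ) ^ 2, 1 / √(e i + τ ^ 2) ≤
      A / τ * (3 - 2 / 2 ^ R) + 4 * B * (2 ^ R * τ) := by
  classical
  induction R with
  | zero =>
    simp only [pow_zero, one_mul]
    have h1 : ∀ i ∈ S.filter (fun i => e i ≤ τ ^ 2), 1 / √(e i + τ ^ 2) ≤ 1 / τ := by
      intro i hi
      gcongr
      exact Real.le_sqrt_of_sq_le (by linarith [he i (Finset.mem_filter.1 hi).1])
    refine (Finset.sum_le_card_nsmul _ _ _ h1).trans ?_
    rw [nsmul_eq_mul]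
    calc ((S.filter fun i => e i ≤ τ ^ 2).card : ℝ) * (1 / τ) ≤ (A + B * τ ^ 2) * (1 / τ) := by
          gcongr
          exact hcount _ (sq_nonneg τ)
      _ = A / τ + B * τ := by field_simp
      _ ≤ _ := by
        have : 0 ≤ B * τ := by positivity
        norm_num
        linarith
  | succ R ih =>
    set E := (2 ^ R * τ) ^ 2 with hE
    set E' := (2 ^ (R + 1) * τ) ^ 2 with hE'
    have hEE' : E' = 4 * E := by rw [hE, hE']; ring
    have hE0 : 0 ≤ E := sq_nonneg _
    rw [← Finset.sum_filter_add_sum_filter_not (S.filter fun i => e i ≤ E') (fun i => e i ≤ E)]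
    have h1 : (S.filter fun i => e i ≤ E').filter (fun i => e i ≤ E) =
        S.filter fun i => e i ≤ E := by
      rw [Finset.filter_filter]
      refine Finset.filter_congr fun i _ => ⟨fun h => h.2, fun h => ⟨by linarith, h⟩⟩
    rw [h1]
    have h2 : ∑ i ∈ (S.filter fun i => e i ≤ E') with ¬ e i ≤ E, 1 / √(e i + τ ^ 2) ≤
        (A + B * E') * (1 / (2 ^ R * τ)) := by
      have h3 : ∀ i ∈ (S.filter fun i => e i ≤ E').filter (fun i => ¬ e i ≤ E),
          1 / √(e i + τ ^ 2) ≤ 1 / (2 ^ R * τ) := by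
        intro i hi
        have h4 := (Finset.mem_filter.1 hi).2
        push Not at h4
        gcongr
        refine Real.le_sqrt_of_sq_le ?_
        have : 0 ≤ τ ^ 2 := sq_nonneg τ
        linarith
      refine (Finset.sum_le_card_nsmul _ _ _ h3).trans ?_
      rw [nsmul_eq_mul]
      gcongr
      refine le_trans ?_ (hcount E' (sq_nonneg _))
      exact_mod_cast Finset.card_le_card (Finset.filter_subset _ _)
    refine (add_le_add ih h2).trans (le_of_eq ?_)
    rw [hE', pow_succ]
    field_simp
    ring

/-- The exceptional terms with `q` in a dyadic block. Points at distance more than `1 / Q ^ 2` from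
the graph are summed trivially, those closer with `sum_inv_sqrt_layer_le`. -/
theorem QuadConvex.exists_dyadic_sum_le {G g : ℝ → ℝ} {a b : ℝ} (H : QuadConvex G g a b)
    {M : ℝ} (hM : 0 ≤ M) :
    ∃ K : ℝ, 0 < K ∧ ∀ k : ℕ, ∀ lam : ℝ, 0 < lam → ∀ S : Finset (ℤ × ℤ),
      (∀ v ∈ S, 2 ^ k ≤ v.1 ∧ v.1 < 2 ^ (k + 1) ∧ |(v.2 : ℝ)| ≤ M * v.1) →
        ∑ v ∈ S, lam / √(v.1 * (distNearestInt (v.1 * G (v.2 / v.1)) + lam)) ≤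
          K * (lam * 4 ^ k + √lam * √2 ^ k * (k + 1)) := by
  classical
  obtain ⟨K, hK, hcount⟩ := H.exists_card_nearness_le hM
  refine ⟨128 * K + 4 * (2 * M + 1), by positivity, fun k lam hlam S hS => ?_⟩
  set Q : ℝ := 2 ^ k with hQ
  have hQ0 : 0 < Q := by positivity
  have hQ1 : 1 ≤ Q := one_le_pow₀ (by norm_num)
  set τ := √(lam / Q) with hτ
  have hτ0 : 0 < τ := Real.sqrt_pos.2 (by positivity)
  have hτ2 : τ ^ 2 = lam / Q := Real.sq_sqrt (by positivity)
  have hv1 : ∀ v ∈ S, Q ≤ v.1 := fun v hv => by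
    have := (hS v hv).1
    rw [hQ]
    exact_mod_cast this
  have he0 : ∀ v ∈ S, 0 ≤ nearness G v := fun v hv =>
    div_nonneg (abs_nonneg _) (hQ0.le.trans (hv1 v hv))
  have hterm : ∀ v ∈ S, lam / √(v.1 * (distNearestInt (v.1 * G (v.2 / v.1)) + lam)) ≤
      lam / Q * (1 / √(nearness G v + τ ^ 2)) := by
    intro v hv
    have h1 := hv1 v hv
    have h2 : (0 : ℝ) < v.1 := hQ0.trans_le h1
    have h3 : distNearestInt (v.1 * G (v.2 / v.1)) = v.1 * nearness G v := by
      rw [nearness]; field_simp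
    have h4 := he0 v hv
    rw [h3, div_mul_div_comm, mul_one, hτ2]
    have h5 : 0 < nearness G v + lam / Q := by positivity
    gcongr
    rw [← Real.sqrt_sq hQ0.le, ← Real.sqrt_mul (sq_nonneg Q), Real.sqrt_sq hQ0.le]
    apply Real.sqrt_le_sqrt
    calc Q ^ 2 * (nearness G v + lam / Q) = Q * (Q * nearness G v + lam) := by field_simp
      _ ≤ _ := by gcongr
  have hcard : (S.card : ℝ) ≤ 4 * (2 * M + 1) * Q ^ 2 := by
    have := card_pairs_le S hM (N := 2 ^ (k + 1)) Nat.one_le_two_pow fun v hv =>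
      ⟨lt_of_lt_of_le (by positivity) (hS v hv).1, by exact_mod_cast (hS v hv).2.1.le,
        (hS v hv).2.2⟩
    push_cast at this
    rw [pow_succ (2 : ℝ) k, ← hQ] at this
    linarith
  set A := 4 * K * Q * (k + 1) with hA
  set B := 16 * K * Q ^ 4 with hB
  have hcnt : ∀ ε : ℝ, 0 ≤ ε → ((S.filter fun v => nearness G v ≤ ε).card : ℝ) ≤ A + B * ε := by
    intro ε hε
    have h1 := hcount (2 ^ (k + 1)) Nat.one_le_two_pow ε hε (S.filter fun v => nearness G v ≤ ε)
      fun v hv => by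
        obtain ⟨hv, hve⟩ := Finset.mem_filter.1 hv
        exact ⟨lt_of_lt_of_le (by positivity) (hS v hv).1, by exact_mod_cast (hS v hv).2.1.le,
          (hS v hv).2.2, hve⟩
    refine h1.trans ?_
    push_cast
    have h2 : Real.log (2 ^ (k + 1)) ≤ k + 1 := by
      rw [Real.log_pow]
      push_cast
      have := Real.log_two_lt_d9
      nlinarith [Nat.cast_nonneg (α := ℝ) k]
    rw [hA, hB]
    calc K * (2 ^ (k + 1) * (1 + Real.log (2 ^ (k + 1))) + ε * (2 ^ (k + 1)) ^ 4)
        ≤ K * (2 ^ (k + 1) * (2 * (k + 1)) + ε * (2 ^ (k + 1)) ^ 4) := by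
          gcongr
          linarith [Nat.cast_nonneg (α := ℝ) k]
      _ = _ := by rw [hQ]; ring
  have hex : ∃ R : ℕ, 1 ≤ 2 ^ R * τ * Q := by
    obtain ⟨R, hR⟩ := pow_unbounded_of_one_lt (1 / (τ * Q)) (show (1 : ℝ) < 2 by norm_num)
    refine ⟨R, ?_⟩
    rw [div_lt_iff₀ (by positivity)] at hR
    linarith
  have hfar : ∀ R : ℕ, 1 ≤ 2 ^ R * τ * Q → ∀ v ∈ S, (2 ^ R * τ) ^ 2 ≤ nearness G v + τ ^ 2 →
      1 / √(nearness G v + τ ^ 2) ≤ Q := by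
    intro R hR v hv h
    have h1 : 2 ^ R * τ ≤ √(nearness G v + τ ^ 2) := Real.le_sqrt_of_sq_le h
    rw [div_le_iff₀ (lt_of_lt_of_le (by positivity) h1)]
    nlinarith
  have hmain : ∑ v ∈ S, 1 / √(nearness G v + τ ^ 2) ≤
      3 * A / τ + 8 * B / Q + 4 * (2 * M + 1) * Q ^ 3 := by
    have hA0 : 0 ≤ A := by positivity
    have hB0 : 0 ≤ B := by positivity
    have hsumfar : ∀ T ⊆ S, (∀ v ∈ T, 1 / √(nearness G v + τ ^ 2) ≤ Q) →
        ∑ v ∈ T, 1 / √(nearness G v + τ ^ 2) ≤ 4 * (2 * M + 1) * Q ^ 3 := by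
      intro T hT h
      refine (Finset.sum_le_card_nsmul _ _ _ h).trans ?_
      rw [nsmul_eq_mul]
      have h1 : (T.card : ℝ) ≤ S.card := by exact_mod_cast Finset.card_le_card hT
      calc (T.card : ℝ) * Q ≤ 4 * (2 * M + 1) * Q ^ 2 * Q := by
            gcongr
            exact h1.trans hcard
        _ = _ := by ring
    -- take the least number of doublings of `τ` that reaches `1 / Q`
    rcases hR : Nat.find hex with _ | R
    · have h1 := Nat.find_spec hex
      rw [hR] at h1
      have h2 := hsumfar S subset_rfl fun v hv => hfar 0 h1 v hv (by
        have := he0 v hv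
        simpa using this)
      have h3 : 0 ≤ 3 * A / τ + 8 * B / Q := by positivity
      linarith
    · have h1 := Nat.find_spec hex
      have h2 := Nat.find_min hex (m := R) (by omega)
      rw [hR] at h1
      push Not at h2
      rw [← Finset.sum_filter_add_sum_filter_not S
        (fun v => nearness G v ≤ (2 ^ (R + 1) * τ) ^ 2)]
      have h3 := sum_inv_sqrt_layer_le S (nearness G) he0 hB0 hτ0 hcnt (R + 1)
      have h4 := hsumfar (S.filter fun v => ¬ nearness G v ≤ (2 ^ (R + 1) * τ) ^ 2)
        (Finset.filter_subset _ _) fun v hv => by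
          obtain ⟨hv, hv'⟩ := Finset.mem_filter.1 hv
          exact hfar (R + 1) h1 v hv (by
            have := sq_nonneg τ
            push Not at hv'
            linarith)
      have h5 : A / τ * (3 - 2 / 2 ^ (R + 1)) ≤ 3 * A / τ := by
        have : 0 ≤ A / τ * (2 / 2 ^ (R + 1)) := by positivity
        have e : 3 * A / τ = A / τ * 3 := by ring
        rw [e]
        linarith
      have h6 : 4 * B * (2 ^ (R + 1) * τ) ≤ 8 * B / Q := by
        rw [le_div_iff₀ hQ0, pow_succ]
        nlinarith
      linarith
  have hlamτ : lam / τ = √lam * √2 ^ k := by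
    have h1 : √2 ^ k = √Q := by
      rw [hQ, ← Real.sqrt_sq (pow_nonneg (Real.sqrt_nonneg 2) k), ← pow_mul, mul_comm k, pow_mul,
        Real.sq_sqrt (by norm_num)]
    rw [h1, hτ, Real.sqrt_div hlam.le, div_div_eq_mul_div, mul_div_right_comm, Real.div_sqrt]
  have hQ4 : (4 : ℝ) ^ k = Q ^ 2 := by
    rw [hQ, ← pow_mul, mul_comm, pow_mul]; norm_num
  calc ∑ v ∈ S, lam / √(v.1 * (distNearestInt (v.1 * G (v.2 / v.1)) + lam))
      ≤ ∑ v ∈ S, lam / Q * (1 / √(nearness G v + τ ^ 2)) := Finset.sum_le_sum hterm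
    _ = lam / Q * ∑ v ∈ S, 1 / √(nearness G v + τ ^ 2) := by rw [Finset.mul_sum]
    _ ≤ lam / Q * (3 * A / τ + 8 * B / Q + 4 * (2 * M + 1) * Q ^ 3) := by gcongr
    _ = 12 * K * ((lam / τ) * (k + 1)) + (128 * K + 4 * (2 * M + 1)) * (lam * Q ^ 2) := by
      rw [hA, hB]
      field_simp
      ring
    _ ≤ _ := by
      rw [hlamτ, hQ4]
      have h1 : 0 ≤ (116 * K + 4 * (2 * M + 1)) * (√lam * √2 ^ k * (k + 1)) := by positivity
      linarith

theorem sum_four_pow_le (n : ℕ) : ∑ k ∈ Finset.range (n + 1), (4 : ℝ) ^ k ≤ 2 * 4 ^ n := by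
  induction n with
  | zero => norm_num
  | succ n ih =>
    rw [Finset.sum_range_succ, pow_succ (4 : ℝ) n]
    have : (0 : ℝ) < 4 ^ n := by positivity
    linarith

theorem sum_sqrt_two_pow_le (n : ℕ) : ∑ k ∈ Finset.range (n + 1), √2 ^ k ≤ 4 * √2 ^ n := by
  have h : (4 / 3 : ℝ) ≤ √2 := Real.le_sqrt_of_sq_le (by norm_num)
  induction n with
  | zero => norm_num
  | succ n ih =>
    rw [Finset.sum_range_succ, pow_succ √2 n]
    have : 0 < √2 ^ n := by positivity
    nlinarith

/-- The sum of all exceptional terms with `q ≤ J`. -/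
theorem QuadConvex.exists_sum_le {G g : ℝ → ℝ} {a b : ℝ} (H : QuadConvex G g a b)
    {M : ℝ} (hM : 0 ≤ M) :
    ∃ K : ℝ, 0 < K ∧ ∀ J : ℕ, 2 ≤ J → ∀ lam : ℝ, 0 < lam → ∀ S : Finset (ℤ × ℤ),
      (∀ v ∈ S, 0 < v.1 ∧ v.1 ≤ J ∧ |(v.2 : ℝ)| ≤ M * v.1) →
        ∑ v ∈ S, lam / √(v.1 * (distNearestInt (v.1 * G (v.2 / v.1)) + lam)) ≤
          K * (lam * (J : ℝ) ^ 2 + √lam * √J * Real.log J) := by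
  classical
  obtain ⟨K, hK, hdy⟩ := H.exists_dyadic_sum_le hM
  refine ⟨16 * K, by positivity, fun J hJ lam hlam S hS => ?_⟩
  have hJ0 : (0 : ℝ) < J := by exact_mod_cast (by omega : 0 < J)
  have hJ2 : (2 : ℝ) ≤ J := by exact_mod_cast hJ
  set n := Nat.log 2 J with hn
  have hnJ : (2 : ℝ) ^ n ≤ J := by exact_mod_cast Nat.pow_log_le_self 2 (by omega)
  have hmaps : ∀ v ∈ S, Nat.log 2 v.1.toNat ∈ Finset.range (n + 1) := fun v hv => by
    rw [Finset.mem_range, Nat.lt_succ_iff]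
    exact Nat.log_mono_right (by have := (hS v hv).2.1; omega)
  rw [← Finset.sum_fiberwise_of_maps_to hmaps]
  have hblock : ∀ k ∈ Finset.range (n + 1),
      ∑ v ∈ S with Nat.log 2 v.1.toNat = k,
        lam / √(v.1 * (distNearestInt (v.1 * G (v.2 / v.1)) + lam)) ≤
      K * lam * 4 ^ k + K * √lam * (n + 1) * √2 ^ k := by
    intro k hk
    have hkn : (k : ℝ) ≤ n := by
      exact_mod_cast Nat.lt_succ_iff.1 (Finset.mem_range.1 hk)
    refine (hdy k lam hlam _ fun v hv => ?_).trans ?_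
    · obtain ⟨hv, hvk⟩ := Finset.mem_filter.1 hv
      obtain ⟨h1, -, h3⟩ := hS v hv
      have h4 : v.1.toNat ≠ 0 := by omega
      have h5 := Nat.pow_log_le_self 2 h4
      have h6 := Nat.lt_pow_succ_log_self (b := 2) (by norm_num) v.1.toNat
      rw [hvk] at h5 h6
      have h7 : (v.1.toNat : ℤ) = v.1 := Int.toNat_of_nonneg h1.le
      refine ⟨?_, ?_, h3⟩
      · rw [← h7]; exact_mod_cast h5
      · rw [← h7]; exact_mod_cast h6
    · have : K * (√lam * √2 ^ k * (k + 1)) ≤ K * (√lam * √2 ^ k * (n + 1)) := by gcongr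
      linarith
  refine (Finset.sum_le_sum hblock).trans ?_
  rw [Finset.sum_add_distrib, ← Finset.mul_sum, ← Finset.mul_sum]
  have h4 : (4 : ℝ) ^ n ≤ (J : ℝ) ^ 2 := by
    calc (4 : ℝ) ^ n = (2 ^ n) ^ 2 := by rw [← pow_mul, mul_comm, pow_mul]; norm_num
      _ ≤ _ := by gcongr
  have h2 : √2 ^ n ≤ √J := by
    apply Real.le_sqrt_of_sq_le
    rw [← pow_mul, mul_comm, pow_mul, Real.sq_sqrt (by norm_num)]
    exact hnJ
  have hlog2 := Real.log_two_gt_d9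
  have hlogJ : Real.log 2 ≤ Real.log J := Real.log_le_log (by norm_num) hJ2
  have hnlog : (n : ℝ) * Real.log 2 ≤ Real.log J := by
    rw [← Real.log_pow]
    exact Real.log_le_log (by positivity) hnJ
  have hn1 : (n : ℝ) + 1 ≤ 4 * Real.log J := by
    nlinarith [Nat.cast_nonneg (α := ℝ) n]
  have hlog0 : 0 ≤ Real.log J := by linarith
  calc K * lam * ∑ k ∈ Finset.range (n + 1), (4 : ℝ) ^ k +
        K * √lam * (n + 1) * ∑ k ∈ Finset.range (n + 1), √2 ^ k
      ≤ K * lam * (2 * (J : ℝ) ^ 2) + K * √lam * (4 * Real.log J) * (4 * √J) := by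
        gcongr
        · exact (sum_four_pow_le n).trans (by gcongr)
        · exact (sum_sqrt_two_pow_le n).trans (by gcongr)
    _ ≤ _ := by
        have : 0 ≤ K * lam * (J : ℝ) ^ 2 := by positivity
        linarith

/-! ### Extension to the line and the main estimate -/

/-- The mean value theorem for points in either order; the sign condition places `z` on the same
side of `x` as `y`. -/
theorem sub_eq_deriv_mul {f f' : ℝ → ℝ} (hf : ∀ x, HasDerivAt f (f' x) x) (x y : ℝ) :
    ∃ z, 0 ≤ (z - x) * (y - x) ∧ f y - f x = f' z * (y - x) := by
  have hc : Continuous f := continuous_iff_continuousAt.2 fun x => (hf x).continuousAt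
  rcases lt_trichotomy x y with h | rfl | h
  · obtain ⟨z, hz, he⟩ := exists_hasDerivAt_eq_slope f f' h hc.continuousOn fun z _ => hf z
    refine ⟨z, mul_nonneg (by linarith [hz.1]) (by linarith), ?_⟩
    rw [he, div_mul_cancel₀ _ (sub_ne_zero.2 h.ne')]
  · exact ⟨x, by simp, by simp⟩
  · obtain ⟨z, hz, he⟩ := exists_hasDerivAt_eq_slope f f' h hc.continuousOn fun z _ => hf z
    refine ⟨z, mul_nonneg_of_nonpos_of_nonpos (by linarith [hz.2]) (by linarith), ?_⟩
    have h1 : x - y ≠ 0 := sub_ne_zero.2 h.ne'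
    rw [he]
    field_simp
    ring

theorem quadConvex_of_hasDerivAt {F g κ : ℝ → ℝ} {c₁ c₂ : ℝ} (hc₁ : 0 < c₁)
    (hF : ∀ x, HasDerivAt F (g x) x) (hg : ∀ x, HasDerivAt g (κ x) x)
    (hκ : ∀ x, c₁ ≤ κ x ∧ κ x ≤ c₂) : QuadConvex F g (c₁ / 2) (c₂ / 2) := by
  have hslope : ∀ x y, c₁ * (y - x) ^ 2 ≤ (g y - g x) * (y - x) ∧
      (g y - g x) * (y - x) ≤ c₂ * (y - x) ^ 2 := by
    intro x y
    obtain ⟨z, -, hz⟩ := sub_eq_deriv_mul hg x y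
    rw [hz]
    have := sq_nonneg (y - x)
    constructor <;> nlinarith [(hκ z).1, (hκ z).2]
  -- compare `F` with the parabolas `c (y - x) ^ 2` through the mean value theorem
  have hpar : ∀ c x y, ∃ z, 0 ≤ (z - x) * (y - x) ∧
      F y - F x - g x * (y - x) - c * (y - x) ^ 2 = (g z - g x - 2 * c * (z - x)) * (y - x) := by
    intro c x y
    have hd : ∀ t, HasDerivAt (fun t => F t - g x * (t - x) - c * (t - x) ^ 2)
        (g t - g x - 2 * c * (t - x)) t := by
      intro t
      have h1 : HasDerivAt (fun t : ℝ => t - x) 1 t := (hasDerivAt_id t).sub_const x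
      have h2 := ((hF t).sub (h1.const_mul (g x))).sub ((h1.pow 2).const_mul c)
      refine h2.congr_deriv ?_
      simp
      ring
    obtain ⟨z, hz, he⟩ := sub_eq_deriv_mul hd x y
    refine ⟨z, hz, ?_⟩
    rw [← he]
    ring
  -- `w` has the sign of `u`, which has the sign of `v`
  have hsign : ∀ {u v w : ℝ}, 0 ≤ u * v → 0 ≤ w * u → (u = 0 → w = 0) → 0 ≤ w * v := by
    intro u v w h1 h2 h3
    rcases eq_or_ne u 0 with h | h
    · simp [h3 h]
    · have h4 : 0 < u ^ 2 := by positivity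
      refine nonneg_of_mul_nonneg_right (a := u ^ 2) ?_ h4
      have := mul_nonneg h1 h2
      nlinarith
  refine ⟨by positivity, fun x y => ?_, fun x y => ?_⟩
  · obtain ⟨z, hz, he⟩ := hpar (c₁ / 2) x y
    have := hsign (w := g z - g x - 2 * (c₁ / 2) * (z - x)) hz (by nlinarith [(hslope x z).1])
      (fun h => by rw [sub_eq_zero] at h; simp [h])
    linarith
  · obtain ⟨z, hz, he⟩ := hpar (c₂ / 2) x y
    have := hsign (w := -(g z - g x - 2 * (c₂ / 2) * (z - x))) hz (by nlinarith [(hslope x z).2])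
      (fun h => by rw [sub_eq_zero] at h; simp [h])
    linarith

theorem surjective_of_hasDerivAt_ge {g κ : ℝ → ℝ} {c₁ : ℝ} (hc₁ : 0 < c₁)
    (hg : ∀ x, HasDerivAt g (κ x) x) (hκ : ∀ x, c₁ ≤ κ x) : Function.Surjective g := by
  have hc : Continuous g := continuous_iff_continuousAt.2 fun x => (hg x).continuousAt
  intro s
  set T := |s - g 0| / c₁ with hT
  have hT0 : 0 ≤ T := by positivity
  have hTc : c₁ * T = |s - g 0| := by rw [hT]; field_simp
  refine mem_range_of_exists_le_of_exists_ge hc ⟨-T, ?_⟩ ⟨T, ?_⟩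
  · obtain ⟨z, -, hz⟩ := sub_eq_deriv_mul hg 0 (-T)
    nlinarith [hκ z, neg_abs_le (s - g 0)]
  · obtain ⟨z, -, hz⟩ := sub_eq_deriv_mul hg 0 T
    nlinarith [hκ z, le_abs_self (s - g 0)]

/-- A `C^2` function with second derivative in `[c₁, c₂]` on an interval extends to the line with
the same bounds: extend the second derivative by constants and integrate twice. All stationary
points then exist, even for slopes not attained on the interval. -/
theorem exists_quadConvex_extension {ξ η : ℝ} (hξη : ξ < η) {f : ℝ → ℝ} {c₁ c₂ : ℝ}
    (hf : ContDiffOn ℝ 2 f (Icc ξ η)) (hc₁ : 0 < c₁)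
    (hf'' : ∀ x ∈ Icc ξ η, c₁ ≤ iteratedDerivWithin 2 f (Icc ξ η) x ∧
      iteratedDerivWithin 2 f (Icc ξ η) x ≤ c₂) :
    ∃ F g : ℝ → ℝ, QuadConvex F g (c₁ / 2) (c₂ / 2) ∧ Function.Surjective g ∧
      ∀ x ∈ Icc ξ η, F x = f x := by
  set I := Icc ξ η with hI
  have hu : UniqueDiffOn ℝ I := uniqueDiffOn_Icc hξη
  have hk : ContinuousOn (iteratedDerivWithin 2 f I) I :=
    hf.continuousOn_iteratedDerivWithin le_rfl hu
  set κ : ℝ → ℝ := IccExtend hξη.le (I.domRestrict (iteratedDerivWithin 2 f I)) with hκ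
  have hκc : Continuous κ := (continuousOn_iff_continuous_domRestrict.1 hk).Icc_extend'
  have hκb : ∀ x, c₁ ≤ κ x ∧ κ x ≤ c₂ := fun x => hf'' _ (projIcc ξ η hξη.le x).2
  have hκI : ∀ x ∈ I, κ x = iteratedDerivWithin 2 f I x := fun x hx => by
    rw [hκ, IccExtend_of_mem _ _ hx, domRestrict_apply]
  set g : ℝ → ℝ := fun x => derivWithin f I ξ + ∫ t in ξ..x, κ t with hg
  have hgd : ∀ x, HasDerivAt g (κ x) x := fun x =>
    (hκc.integral_hasStrictDerivAt ξ x).hasDerivAt.const_add _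
  have hgc : Continuous g := continuous_iff_continuousAt.2 fun x => (hgd x).continuousAt
  set F : ℝ → ℝ := fun x => f ξ + ∫ t in ξ..x, g t with hF
  have hFd : ∀ x, HasDerivAt F (g x) x := fun x =>
    (hgc.integral_hasStrictDerivAt ξ x).hasDerivAt.const_add _
  have hf1 : ContDiffOn ℝ 1 (derivWithin f I) I :=
    hf.derivWithin hu (by norm_num)
  have hgI : ∀ x ∈ I, g x = derivWithin f I x := by
    refine eq_of_derivWithin_eq (fun x _ => (hgd x).differentiableAt.differentiableWithinAt)
      (hf1.differentiableOn (by norm_num)) (fun x hx => ?_) (by simp [hg])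
    have hxI : x ∈ I := Ico_subset_Icc_self hx
    rw [(hgd x).hasDerivWithinAt.derivWithin (hu x hxI), hκI x hxI, iteratedDerivWithin_succ]
    refine derivWithin_congr (fun y hy => ?_) ?_
    · exact congrFun iteratedDerivWithin_one y
    · exact congrFun iteratedDerivWithin_one x
  refine ⟨F, g, quadConvex_of_hasDerivAt hc₁ hFd hgd hκb,
    surjective_of_hasDerivAt_ge hc₁ hgd fun x => (hκb x).1, ?_⟩
  refine eq_of_derivWithin_eq (fun x _ => (hFd x).differentiableAt.differentiableWithinAt)
      (hf.differentiableOn (by norm_num)) (fun x hx => ?_) (by simp [hF])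
  have hxI : x ∈ I := Ico_subset_Icc_self hx
  rw [(hFd x).hasDerivWithinAt.derivWithin (hu x hxI), hgI x hxI]

/-- The main estimate for a globally defined convex function. Up to sign, a pair with `j₂ ≠ 0` is
the phase `q f - p x` with `q = |j₂|` and `p = ±j₁`. -/
theorem QuadConvex.exists_sum_muSet_le {f g : ℝ → ℝ} {a b : ℝ} (H : QuadConvex f g a b)
    (hg : Function.Surjective g) {ξ η : ℝ} (hξη : ξ < η) :
    ∃ C : ℝ, 0 < C ∧ ∀ J : ℕ, 2 ≤ J → ∀ lam : ℝ, 0 < lam → lam < 1 / 2 →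
      ∑ j ∈ nonzeroBox J, volume.real (muSet f ξ η j.1 j.2 lam) ≤
        C * (lam * (J : ℝ) ^ 2 + √lam * √J * Real.log J) := by
  classical
  choose h hh using hg
  obtain ⟨C, M, hC, hM, hvol⟩ := H.volume_real_le hh hξη
  obtain ⟨K, hK, hsum⟩ := (H.dual hh).exists_sum_le hM.le
  have hl : 0 < η - ξ := sub_pos.2 hξη
  refine ⟨36 * (η - ξ) + 9 * (2 * (η - ξ) + 4) + 6 * C + 2 * C * K, by positivity,
    fun J hJ lam hlam hlam2 => ?_⟩
  have hJ0 : (0 : ℝ) < J := by exact_mod_cast (by omega : 0 < J)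
  have hJ1 : (1 : ℝ) ≤ J := by exact_mod_cast (by omega : 1 ≤ J)
  have hlog : 0 ≤ Real.log J := Real.log_nonneg hJ1
  set X := lam * (J : ℝ) ^ 2 with hX
  set Y := √lam * √J * Real.log J with hY
  have hX0 : 0 ≤ X := by positivity
  have hY0 : 0 ≤ Y := by positivity
  have hbox : ((nonzeroBox J).card : ℝ) ≤ 9 * (J : ℝ) ^ 2 := by
    have h1 : (nonzeroBox J).card ≤ (2 * J + 1) * (2 * J + 1) := by
      refine (Finset.card_le_card (Finset.erase_subset _ _)).trans (le_of_eq ?_)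
      rw [Finset.card_product, Int.card_Icc]
      congr 1 <;> omega
    have h2 : ((nonzeroBox J).card : ℝ) ≤ (2 * J + 1) * (2 * J + 1) := by exact_mod_cast h1
    nlinarith
  rcases lt_or_ge (1 / 4) lam with hbig | hsmall
  · have h1 : ∀ j ∈ nonzeroBox J, volume.real (muSet f ξ η j.1 j.2 lam) ≤ η - ξ := by
      intro j _
      have h2 : volume.real (muSet f ξ η j.1 j.2 lam) ≤ volume.real (Icc ξ η) :=
        measureReal_mono (fun x hx => hx.1) measure_Icc_lt_top.ne
      rwa [Real.volume_real_Icc_of_le hξη.le] at h2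
    refine (Finset.sum_le_card_nsmul _ _ _ h1).trans ?_
    rw [nsmul_eq_mul]
    have h2 : (J : ℝ) ^ 2 ≤ 4 * X := by
      rw [hX]; nlinarith [sq_nonneg (J : ℝ)]
    calc ((nonzeroBox J).card : ℝ) * (η - ξ) ≤ 9 * (4 * X) * (η - ξ) := by
          gcongr
          linarith
      _ = 36 * (η - ξ) * X := by ring
      _ ≤ (36 * (η - ξ) + 9 * (2 * (η - ξ) + 4) + 6 * C + 2 * C * K) * (X + Y) := by
          gcongr
          · have : 0 ≤ 9 * (2 * (η - ξ) + 4) + 6 * C + 2 * C * K := by positivity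
            linarith
          · linarith
  set Gd : ℝ → ℝ := fun s => s * h s - f (h s) with hGd
  set W : ℤ × ℤ → ℝ := fun v => lam / √(v.1 * (distNearestInt (v.1 * Gd (v.2 / v.1)) + lam)) with hW
  set Φ : ℤ × ℤ → ℝ := fun v => C * lam + if |(v.2 : ℝ)| ≤ M * v.1 then C * W v else 0 with hΦ
  have hΦ0 : ∀ v, 0 ≤ Φ v := fun v => by
    have : 0 ≤ W v := by positivity
    simp only [hΦ]
    split_ifs <;> positivity
  have hvol' : ∀ q p : ℤ, 0 < q →
      volume.real {x | x ∈ Icc ξ η ∧ distNearestInt (q * f x - p * x) < lam} ≤ Φ (q, p) := by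
    intro q p hq
    exact hvol lam hlam hsmall q p (by exact_mod_cast hq)
  set T : Finset (ℤ × ℤ) := Finset.Icc 1 (J : ℤ) ×ˢ Finset.Icc (-(J : ℤ)) J with hT
  have hTsum : ∑ v ∈ T, Φ v ≤ 3 * C * X + C * K * (X + Y) := by
    simp only [hΦ]
    rw [Finset.sum_add_distrib, ← Finset.sum_filter, Finset.sum_const, nsmul_eq_mul,
      ← Finset.mul_sum]
    have h1 : (T.card : ℝ) ≤ 3 * (J : ℝ) ^ 2 := by
      have h2 : T.card = J * (2 * J + 1) := by
        rw [hT, Finset.card_product, Int.card_Icc, Int.card_Icc]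
        congr 1 <;> omega
      rw [h2]
      push_cast
      nlinarith
    have h2 := hsum J hJ lam hlam (T.filter fun v => |(v.2 : ℝ)| ≤ M * v.1) fun v hv => by
      obtain ⟨hv, hv2⟩ := Finset.mem_filter.1 hv
      have := Finset.mem_Icc.1 (Finset.mem_product.1 hv).1
      exact ⟨by omega, this.2, hv2⟩
    calc (T.card : ℝ) * (C * lam) + C * ∑ v ∈ T with |(v.2 : ℝ)| ≤ M * v.1, W v
        ≤ 3 * (J : ℝ) ^ 2 * (C * lam) + C * (K * (X + Y)) := by gcongr
      _ = 3 * C * X + C * K * (X + Y) := by rw [hX]; ring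
  have hpart : ∀ (S : Finset (ℤ × ℤ)) (φ : ℤ × ℤ → ℤ × ℤ), Function.Injective φ →
      (∀ j ∈ S, φ j ∈ T ∧ volume.real (muSet f ξ η j.1 j.2 lam) ≤ Φ (φ j)) →
      ∑ j ∈ S, volume.real (muSet f ξ η j.1 j.2 lam) ≤ 3 * C * X + C * K * (X + Y) := by
    intro S φ hφ hS
    calc ∑ j ∈ S, volume.real (muSet f ξ η j.1 j.2 lam) ≤ ∑ j ∈ S, Φ (φ j) :=
          Finset.sum_le_sum fun j hj => (hS j hj).2
      _ = ∑ v ∈ S.image φ, Φ v := (Finset.sum_image fun x _ y _ hxy => hφ hxy).symm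
      _ ≤ ∑ v ∈ T, Φ v := Finset.sum_le_sum_of_subset_of_nonneg (fun v hv => by
          obtain ⟨j, hj, rfl⟩ := Finset.mem_image.1 hv
          exact (hS j hj).1) fun v _ _ => hΦ0 v
      _ ≤ _ := hTsum
  have hmem : ∀ j ∈ nonzeroBox J, j ≠ (0, 0) ∧ (-(J : ℤ) ≤ j.1 ∧ j.1 ≤ J) ∧
      (-(J : ℤ) ≤ j.2 ∧ j.2 ≤ J) := by
    intro j hj
    rw [nonzeroBox, Finset.mem_erase, Finset.mem_product, Finset.mem_Icc, Finset.mem_Icc] at hj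
    exact hj
  have hpos := hpart ((nonzeroBox J).filter fun j => 0 < j.2) (fun j => (j.2, -j.1))
    (fun x y hxy => by
      simp only [Prod.mk.injEq, neg_inj] at hxy
      exact Prod.ext hxy.2 hxy.1)
    (fun j hj => by
      obtain ⟨hj, hj2⟩ := Finset.mem_filter.1 hj
      obtain ⟨-, h1, h2⟩ := hmem j hj
      refine ⟨Finset.mem_product.2 ⟨Finset.mem_Icc.2 ⟨by simp only; omega, h2.2⟩,
        Finset.mem_Icc.2 ⟨by simp only; omega, by simp only; omega⟩⟩, ?_⟩
      refine le_trans (le_of_eq ?_) (hvol' j.2 (-j.1) hj2)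
      congr 1
      ext x
      simp only [muSet, mem_ofPred_eq]
      rw [show (j.1 : ℝ) * x + j.2 * f x = j.2 * f x - ((-j.1 : ℤ) : ℝ) * x by push_cast; ring])
  have hneg := hpart ((nonzeroBox J).filter fun j => j.2 < 0) (fun j => (-j.2, j.1))
    (fun x y hxy => by
      simp only [Prod.mk.injEq, neg_inj] at hxy
      exact Prod.ext hxy.2 hxy.1)
    (fun j hj => by
      obtain ⟨hj, hj2⟩ := Finset.mem_filter.1 hj
      obtain ⟨-, h1, h2⟩ := hmem j hj
      refine ⟨Finset.mem_product.2 ⟨Finset.mem_Icc.2 ⟨by simp only; omega, by simp only; omega⟩,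
        Finset.mem_Icc.2 ⟨h1.1, h1.2⟩⟩, ?_⟩
      refine le_trans (le_of_eq ?_) (hvol' (-j.2) j.1 (by omega))
      congr 1
      ext x
      simp only [muSet, mem_ofPred_eq]
      rw [← distNearestInt_neg,
        show -((j.1 : ℝ) * x + j.2 * f x) = ((-j.2 : ℤ) : ℝ) * f x - j.1 * x by push_cast; ring])
  have hzero : ∑ j ∈ nonzeroBox J with j.2 = 0, volume.real (muSet f ξ η j.1 j.2 lam) ≤
      9 * (2 * (η - ξ) + 4) * X := by
    have h1 : ∀ j ∈ (nonzeroBox J).filter (fun j => j.2 = 0),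
        volume.real (muSet f ξ η j.1 j.2 lam) ≤ (2 * (η - ξ) + 4) * lam := by
      intro j hj
      obtain ⟨hj, hj2⟩ := Finset.mem_filter.1 hj
      have h2 : j.1 ≠ 0 := fun h0 => (hmem j hj).1 (Prod.ext h0 hj2)
      have h3 : (1 : ℝ) ≤ |(j.1 : ℝ)| := by exact_mod_cast Int.one_le_abs h2
      refine le_trans (le_of_eq ?_) (volume_real_linear_le hξη hlam h3)
      simp [muSet, hj2]
    refine (Finset.sum_le_card_nsmul _ _ _ h1).trans ?_
    rw [nsmul_eq_mul]
    have h2 : (((nonzeroBox J).filter fun j => j.2 = 0).card : ℝ) ≤ 9 * (J : ℝ) ^ 2 :=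
      le_trans (by exact_mod_cast Finset.card_le_card (Finset.filter_subset _ _)) hbox
    calc (((nonzeroBox J).filter fun j => j.2 = 0).card : ℝ) * ((2 * (η - ξ) + 4) * lam)
        ≤ 9 * (J : ℝ) ^ 2 * ((2 * (η - ξ) + 4) * lam) := by gcongr
      _ = _ := by rw [hX]; ring
  have hsplit : ∑ j ∈ nonzeroBox J, volume.real (muSet f ξ η j.1 j.2 lam) =
      ∑ j ∈ nonzeroBox J with 0 < j.2, volume.real (muSet f ξ η j.1 j.2 lam) +
      (∑ j ∈ nonzeroBox J with j.2 < 0, volume.real (muSet f ξ η j.1 j.2 lam) +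
      ∑ j ∈ nonzeroBox J with j.2 = 0, volume.real (muSet f ξ η j.1 j.2 lam)) := by
    rw [← Finset.sum_filter_add_sum_filter_not (nonzeroBox J) (fun j => 0 < j.2)]
    congr 1
    rw [← Finset.sum_filter_add_sum_filter_not _ (fun j : ℤ × ℤ => j.2 < 0), Finset.filter_filter,
      Finset.filter_filter]
    congr 2
    · exact Finset.filter_congr fun j _ => by omega
    · exact Finset.filter_congr fun j _ => by omega
  rw [hsplit]
  have h1 : 0 ≤ 36 * (η - ξ) * (X + Y) := by positivity
  have h2 : 0 ≤ (9 * (2 * (η - ξ) + 4) + 6 * C) * Y := by positivity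
  linarith

theorem proposition1 (ξ η : ℝ) (hξη : ξ < η) (f : ℝ → ℝ) (c₁ c₂ : ℝ)
    (hf : ContDiffOn ℝ 2 f (Set.Icc ξ η)) (hc₁ : 0 < c₁)
    (hf'' : ∀ x ∈ Set.Icc ξ η,
      c₁ ≤ |iteratedDerivWithin 2 f (Set.Icc ξ η) x| ∧
        |iteratedDerivWithin 2 f (Set.Icc ξ η) x| ≤ c₂) :
    ∃ C : ℝ, 0 < C ∧ ∀ J : ℕ, 2 ≤ J → ∀ lam : ℝ, 0 < lam → lam < 1 / 2 →
      ∑ j ∈ nonzeroBox J, MeasureTheory.volume.real (muSet f ξ η j.1 j.2 lam) ≤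
        C * (lam * (J : ℝ) ^ 2 +
          lam ^ (1 / 2 : ℝ) * (J : ℝ) ^ (1 / 2 : ℝ) * Real.log (J : ℝ)) := by
  simp_rw [← Real.sqrt_eq_rpow]
  have hu : UniqueDiffOn ℝ (Icc ξ η) := uniqueDiffOn_Icc hξη
  have hk : ContinuousOn (iteratedDerivWithin 2 f (Icc ξ η)) (Icc ξ η) :=
    hf.continuousOn_iteratedDerivWithin le_rfl hu
  have hne : ∀ x ∈ Icc ξ η, iteratedDerivWithin 2 f (Icc ξ η) x ≠ 0 := fun x hx h0 => by
    have := (hf'' x hx).1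
    rw [h0, abs_zero] at this
    linarith
  -- the second derivative does not vanish, hence has constant sign
  have hsign : (∀ x ∈ Icc ξ η, 0 < iteratedDerivWithin 2 f (Icc ξ η) x) ∨
      ∀ x ∈ Icc ξ η, iteratedDerivWithin 2 f (Icc ξ η) x < 0 := by
    by_contra hcon
    push Not at hcon
    obtain ⟨⟨x, hx, hx0⟩, y, hy, hy0⟩ := hcon
    obtain ⟨z, hz, hz0⟩ := isPreconnected_Icc.intermediate_value hx hy hk ⟨hx0, hy0⟩
    exact hne z hz hz0
  rcases hsign with hs | hs
  · obtain ⟨F, g, H, hg, hFf⟩ := exists_quadConvex_extension hξη hf hc₁ fun x hx => by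
      have := hf'' x hx
      rwa [abs_of_pos (hs x hx)] at this
    obtain ⟨C, hC, hmain⟩ := H.exists_sum_muSet_le hg hξη
    refine ⟨C, hC, fun J hJ lam hlam hlam2 => ?_⟩
    refine le_trans (le_of_eq (Finset.sum_congr rfl fun j _ => ?_)) (hmain J hJ lam hlam hlam2)
    congr 1
    ext x
    simp only [muSet, mem_ofPred_eq]
    exact and_congr_right fun hx => by rw [hFf x hx]
  · have hneg : ∀ x ∈ Icc ξ η, iteratedDerivWithin 2 (-f) (Icc ξ η) x =
        -iteratedDerivWithin 2 f (Icc ξ η) x := fun x hx => iteratedDerivWithin_neg f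
    obtain ⟨F, g, H, hg, hFf⟩ := exists_quadConvex_extension hξη hf.neg hc₁ fun x hx => by
      have := hf'' x hx
      rw [abs_of_neg (hs x hx)] at this
      rw [← hneg x hx] at this
      exact this
    obtain ⟨C, hC, hmain⟩ := H.exists_sum_muSet_le hg hξη
    refine ⟨C, hC, fun J hJ lam hlam hlam2 => ?_⟩
    refine le_trans (le_of_eq ?_) (hmain J hJ lam hlam hlam2)
    -- the reflection `(j₁, j₂) ↦ (j₁, -j₂)` of the box
    refine Finset.sum_nbij' (fun j => (j.1, -j.2)) (fun j => (j.1, -j.2)) ?_ ?_ ?_ ?_ ?_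
    · intro j hj
      simp only [nonzeroBox, Finset.mem_erase, Finset.mem_product, Finset.mem_Icc, ne_eq,
        Prod.ext_iff] at hj ⊢
      omega
    · intro j hj
      simp only [nonzeroBox, Finset.mem_erase, Finset.mem_product, Finset.mem_Icc, ne_eq,
        Prod.ext_iff] at hj ⊢
      omega
    · intro j _; simp
    · intro j _; simp
    · intro j _
      congr 1
      ext x
      simp only [muSet, mem_ofPred_eq]
      refine and_congr_right fun hx => ?_
      rw [hFf x hx]
      push_cast
      rw [neg_mul_neg]
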